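/- **Setting.** A *network* $\mathcal N\subset\mathbb R^n$ consists of finitely many distinct points $x_i$, $i\in\mathcal I$ (vertices), and finitely many arcs $e_j=\pi_j((0,\ell_j))$, $j\in\mathcal J$ (edges), where $\ell_j\in(0,\infty)$ and $\pi_j:[0,\ell_j]\to\mathbb R^n$ is a $C^1$ diffeomorphism onto its image, with $\pi_j(0),\pi_j(\ell_j)$ vertices; distinct edges are disjoint and contain no vertices, so closed edges meet only at vertices, and $\mathcal N$ is connected. Put $\mathrm{Inc}_i=\{j:x_i\in\bar e_j\}$. A nonempty set of vertices $\partial\mathcal N=\{x_i\}_{i\in\mathcal I_B}$ is given, containing every $x_i$ with $\#\mathrm{Inc}_i=1$; $\mathcal I_T=\mathcal I\setminus\mathcal I_B$ and $\overset{\circ}{\mathcal N}=\mathcal N\setminus\partial\mathcal N$. For $u$ on $\mathcal N$ (or on $\prod_j\bar e_j$), $u_j=u\circ\pi_j$ on $[0,\ell_j]$. $C(\mathcal N)$ (resp. $C^1(\mathcal N)$) is the set of continuous functions $u$ on $\mathcal N$ (resp. with all $u_j\in C^1([0,\ell_j])$), while $L^\infty(\mathcal N)=\prod_jL^\infty(0,\ell_j)$,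 $W^{1,\infty}(\mathcal N)=\prod_jW^{1,\infty}(0,\ell_j)$ and $\int_{\mathcal N}u=\sum_j\int_0^{\ell_j}u_j$. $D_ju(\pi_j(t))=u_j'(t)$ for $t\in(0,\ell_j)$, and $D_ju(x_i)$ is the one-sided derivative at $x_i$ along $e_j$ in the direction pointing into $e_j$. If $D_ju(x_i)$ exists and is nonzero, $\sigma_{ij}(u)$ is its sign; $\mathrm{Inc}_i^\pm(u)=\{j\in\mathrm{Inc}_i:\sigma_{ij}(u)=\pm1\}$. Let $\eta=(\eta_j)$ with $\eta_j\in C([0,\ell_j])$, $\eta_j>0$. Let $f\in L^\infty(\mathcal N)$, $f\ge0$ a.e., $f$ not a.e. zero. For each $i\in\mathcal I_T$ and each nonempty $A\subset\mathrm{Inc}_i$ let positive coefficients $(C_{ij})_{j\in A}$ with $\sum_{j\in A}C_{ij}=1$ be given. Let $\mathcal D(x,y)$ be the infimum of the weighted lengths of paths along $\mathcal N$ from $x$ to $y$, i.e. finite chains of closed edges or sub-edges joined at vertices, the piece of $\bar e_j$ between parameters $s,t$ having length $|\int_s^t 1/\eta_j|$, and let $d(x)=\min_{y\in\partial\mathcal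 N}\mathcal D(x,y)$. **Solutions.** For edgewise defined $v$, $v(x_i)\neq0$ means $v_j(\pi_j^{-1}(x_i))\ne0$ for some $j\in\mathrm{Inc}_i$. A pair $(u,v)$ is a *solution of the sandpile system* if (i) each $v_j\in C([0,\ell_j])$ and $v\ge0$; (ii) $u\in W^{1,\infty}(\mathcal N)\cap C(\mathcal N)$, $u\ge0$, $\eta|Du|\le1$ a.e., and $u$ is a viscosity solution of $|Du|-1/\eta=0$ in $\{x\in\overset{\circ}{\mathcal N}:v(x)\ne0\}$: for every $\phi\in C^1(\mathcal N)$ and every $x$ in this set, if $x\in e_j$ then $|D_j\phi(x)|\le 1/\eta_j(x)$ whenever $u-\phi$ has a local maximum at $x$, and $|D_j\phi(x)|\ge1/\eta_j(x)$ whenever $u-\phi$ has a local minimum at $x$; if $x=x_i$, $i\in\mathcal I_T$, then $\max_{j\in\mathrm{Inc}_i}\{|D_j\phi(x_i)|-1/\eta_j(x_i)\}\ge0$ whenever $u-\phi$ has a local minimum at $x_i$ (local extrema are relative to $\mathcal N$); (iii) $\int_{\mathcal N}v\,\eta\,Du\,D\psi=\int_{\mathcal N}f\psi$ for all $\psi\in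 W^{1,\infty}(\mathcal N)\cap C(\mathcal N)$ with $\psi=0$ on $\partial\mathcal N$; (iv) $u=0$ on $\partial\mathcal N$, and for each $i\in\mathcal I_T$: $v_j(\pi_j^{-1}(x_i))=0$ if $j\in\mathrm{Inc}_i$ and $\sigma_{ij}(u)$ is not defined; and $v_j(\pi_j^{-1}(x_i))=C_{ij}\sum_{k\in\mathrm{Inc}_i^+(u)}v_k(\pi_k^{-1}(x_i))$ if $j\in\mathrm{Inc}_i^-(u)$, with the coefficients attached to $A=\mathrm{Inc}_i^-(u)$. **Projection.** Let $S_j(d)=\{t\in(0,\ell_j):d_j\text{ is not differentiable at }t\}$, $T_j(d)=\{\pi_j^{-1}(x_i):j\in\mathrm{Inc}_i^-(d)\}$, $\Sigma_j(d)=S_j(d)\cup T_j(d)$, and $S(d)=\bigcup_j\pi_j(S_j(d))\cup\{x_i: d\text{ has a local maximum at }x_i\}$. For $t\in[0,\ell_j]$ let $\tau_j(t)=\min\{s\ge0:t+s\,\eta_j(t)d_j'(t)\in\Sigma_j(d)\}$ and $P_j(t)=t+\tau_j(t)\eta_j(t)d_j'(t)$, with one-sided $d_j'$ at $0,\ell_j$,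 and $\tau_j(t)=0$, $P_j(t)=t$ for $t\in S_j(d)$. **Theorem.** Each $\Sigma_j(d)$ is a singleton and the minima defining $\tau_j$ are attained. There is exactly one $v^f=(v^f_j)_{j\in\mathcal J}$, $v_j^f:[0,\ell_j]\to\mathbb R$, such that for all $j\in\mathcal J$ and $t\in[0,\ell_j]$ $$v^f_j(t)=\int_0^{\tau_j(t)}f_j\big(t+r\,\eta_j(t)d_j'(t)\big)\,dr+\Big(C_{ij}\sum_{k\in\mathrm{Inc}_i^+(d)}v^f_k(\pi_k^{-1}(x_i))\Big)\chi_{T_j(d)}(P_j(t)),\qquad x_i=\pi_j(P_j(t)),$$ where the $C_{ij}$ are those attached to $A=\mathrm{Inc}_i^-(d)$ and the last term is $0$ if $P_j(t)\notin T_j(d)$. The pair $(d,v^f)$ is a solution of the sandpile system. Moreover $v^f$ vanishes on $S(d)$ (at a vertex of $S(d)$, along all incident edges), $v^f\in W^{1,\infty}(\mathcal N)$, and the conservation law $-(v^f_j\,\eta_j\,d_j')'(t)=f_j(t)$ holds in the classical sense for almost every $t\in(0,\ell_j)\setminus S_j(d)$, and at every $t\in(0,\ell_j)\setminus S_j(d)$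 at which (the chosen representative of) $f_j$ is continuous, for every $j\in\mathcal J$. -/

import Mathlib

open Set Filter Topology MeasureTheory
open scoped ContDiff

/-- A finite connected network in `ℝⁿ`: distinct vertices `vertex i`, and edges given by
diffeomorphisms `param j` of `[0, len j]` onto closed arcs whose two end points are vertices.
Arcs are not self-intersecting and different edges can meet at vertices only. A nonempty set of
vertices is declared to be the boundary; it contains every vertex with exactly one incident edge. -/
structure Network (n : ℕ) (I J : Type*) where
  vertex : I → EuclideanSpace ℝ (Fin n)
  vertex_injective : Function.Injective vertex
  len : J → ℝ
  len_pos : ∀ j, 0 < len j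
  param : J → ℝ → EuclideanSpace ℝ (Fin n)
  param_contDiffOn : ∀ j, ContDiffOn ℝ 1 (param j) (Icc 0 (len j))
  param_injOn : ∀ j, InjOn (param j) (Icc 0 (len j))
  param_deriv_ne : ∀ j, ∀ t ∈ Icc 0 (len j), derivWithin (param j) (Icc 0 (len j)) t ≠ 0
  param_zero : ∀ j, ∃ i, param j 0 = vertex i
  param_len : ∀ j, ∃ i, param j (len j) = vertex i
  vertex_not_interior : ∀ j, ∀ t ∈ Ioo 0 (len j), ∀ i, param j t ≠ vertex i
  edges_disjoint : ∀ j k, ∀ s ∈ Ioo 0 (len j), ∀ t ∈ Ioo 0 (len k),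
    param j s = param k t → j = k
  connected : ∀ i i', Relation.ReflTransGen
    (fun a b => ∃ j, vertex a ∈ param j '' Icc 0 (len j) ∧ vertex b ∈ param j '' Icc 0 (len j)) i i'
  boundary : Set I
  boundary_nonempty : boundary.Nonempty
  end_mem_boundary : ∀ i, (∃! j, vertex i ∈ param j '' Icc 0 (len j)) → i ∈ boundary

/-- The Lebesgue measure on the parameter interval `(0, L)`. -/
noncomputable def edgeMeasure (L : ℝ) : Measure ℝ := volume.restrict (Ioo 0 L)

/-- `g'` is a weak derivative of `g` on `(0, L)`. -/
def HasWeakDeriv (L : ℝ) (g g' : ℝ → ℝ) : Prop :=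
  ∀ φ : ℝ → ℝ, ContDiff ℝ ∞ φ → HasCompactSupport φ → tsupport φ ⊆ Ioo 0 L →
    ∫ t in 0..L, g t * deriv φ t = - ∫ t in 0..L, g' t * φ t

/-- `g ∈ W^{1,∞}(0, L)`, with weak derivative `g'`. -/
def IsW1InftyWith (L : ℝ) (g g' : ℝ → ℝ) : Prop :=
  MemLp g ⊤ (edgeMeasure L) ∧ MemLp g' ⊤ (edgeMeasure L) ∧ HasWeakDeriv L g g'

namespace Network

section

variable {n : ℕ} {I J : Type*} (N : Network n I J)

/-- The set of points of the network. -/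
def carrier : Set (EuclideanSpace ℝ (Fin n)) :=
  range N.vertex ∪ ⋃ j, N.param j '' Icc 0 (N.len j)

/-- The points of the network that are not boundary vertices. -/
def inner : Set (EuclideanSpace ℝ (Fin n)) := N.carrier \ (N.vertex '' N.boundary)

/-- `j ∈ Inc_i`: the closed edge `j` contains the vertex `i`. -/
def Incident (i : I) (j : J) : Prop := N.vertex i ∈ N.param j '' Icc 0 (N.len j)

/-- The parameter on the edge `j` of a point of the closed edge `j`. -/
noncomputable def paramInv (j : J) (x : EuclideanSpace ℝ (Fin n)) : ℝ :=
  Function.invFunOn (N.param j) (Icc 0 (N.len j)) x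

/-- The projection `u_j` of a function on the network. -/
def proj (u : EuclideanSpace ℝ (Fin n) → ℝ) (j : J) (t : ℝ) : ℝ := u (N.param j t)

/-- `u ∈ C(N)`. The values at the vertices match because `u` is a function of the point. -/
def IsCont (u : EuclideanSpace ℝ (Fin n) → ℝ) : Prop :=
  ∀ j, ContinuousOn (N.proj u j) (Icc 0 (N.len j))

/-- `φ ∈ C¹(N)`. -/
def IsC1 (φ : EuclideanSpace ℝ (Fin n) → ℝ) : Prop :=
  ∀ j, ContDiffOn ℝ 1 (N.proj φ j) (Icc 0 (N.len j))

/-- The oriented derivative of `u` at the vertex `i` along the incident edge `j`, in the direction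
from the vertex into the edge, exists and is `p`. -/
def HasOrientedDeriv (u : EuclideanSpace ℝ (Fin n) → ℝ) (i : I) (j : J) (p : ℝ) : Prop :=
  (N.vertex i = N.param j 0 ∧ HasDerivWithinAt (N.proj u j) p (Icc 0 (N.len j)) 0) ∨
  (N.vertex i = N.param j (N.len j) ∧
    HasDerivWithinAt (N.proj u j) (-p) (Icc 0 (N.len j)) (N.len j))

/-- The slope `σ_{ij}(u)` is defined: the oriented derivative exists and is not zero. -/
def SlopeDefined (u : EuclideanSpace ℝ (Fin n) → ℝ) (i : I) (j : J) : Prop :=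
  ∃ p, p ≠ 0 ∧ N.HasOrientedDeriv u i j p

open Classical in
/-- `Inc_i^+(u)`: the incident edges along which `u` leaves the vertex `i` uphill. -/
noncomputable def incPlus [Fintype J] (u : EuclideanSpace ℝ (Fin n) → ℝ) (i : I) : Finset J :=
  Finset.univ.filter fun j => N.Incident i j ∧ ∃ p, 0 < p ∧ N.HasOrientedDeriv u i j p

open Classical in
/-- `Inc_i^-(u)`: the incident edges along which `u` leaves the vertex `i` downhill. -/
noncomputable def incMinus [Fintype J] (u : EuclideanSpace ℝ (Fin n) → ℝ) (i : I) : Finset J :=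
  Finset.univ.filter fun j => N.Incident i j ∧ ∃ p, p < 0 ∧ N.HasOrientedDeriv u i j p

/-- The data `η`: continuous and positive on each closed edge, possibly two-valued at vertices. -/
def IsCapacity (η : J → ℝ → ℝ) : Prop :=
  ∀ j, ContinuousOn (η j) (Icc 0 (N.len j)) ∧ ∀ t ∈ Icc 0 (N.len j), 0 < η j t

/-- The data `f`: essentially bounded, nonnegative, not almost everywhere zero. -/
def IsSource (f : J → ℝ → ℝ) : Prop :=
  (∀ j, MemLp (f j) ⊤ (edgeMeasure (N.len j))) ∧
  (∀ j, ∀ᵐ t ∂(edgeMeasure (N.len j)), 0 ≤ f j t) ∧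
  ∃ j, ¬ ∀ᵐ t ∂(edgeMeasure (N.len j)), f j t = 0

/-- The distribution coefficients: to each transition vertex `i` and each nonempty set `A` of edges
incident to it, a family `(C i A j)`, `j ∈ A`, of positive numbers with sum `1`. -/
def IsDistribution (C : I → Finset J → J → ℝ) : Prop :=
  ∀ i, i ∉ N.boundary → ∀ A : Finset J, A.Nonempty → (∀ j ∈ A, N.Incident i j) →
    (∀ j ∈ A, 0 < C i A j) ∧ ∑ j ∈ A, C i A j = 1

/-! ### The weighted distance -/

/-- `N.IsPathLength η x y L`: there is a path along the network from `x` to `y` of weighted length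
`L`. A path is a finite chain of closed edges or sub-edges, consecutive ones being joined at a
vertex; a piece of the edge `j` between the parameters `s` and `t` has length `|∫ₛᵗ 1/η_j|`. -/
inductive IsPathLength (η : J → ℝ → ℝ) :
    EuclideanSpace ℝ (Fin n) → EuclideanSpace ℝ (Fin n) → ℝ → Prop
  | single (j : J) (s t : ℝ) (hs : s ∈ Icc 0 (N.len j)) (ht : t ∈ Icc 0 (N.len j)) :
      IsPathLength η (N.param j s) (N.param j t) |∫ r in s..t, 1 / η j r|
  | cons (j : J) (s t : ℝ) (hs : s ∈ Icc 0 (N.len j)) (ht : t ∈ Icc 0 (N.len j)) (i : I)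
      (hi : N.param j t = N.vertex i) (y : EuclideanSpace ℝ (Fin n)) (L : ℝ)
      (h : IsPathLength η (N.vertex i) y L) :
      IsPathLength η (N.param j s) y (|∫ r in s..t, 1 / η j r| + L)

/-- The weighted distance between two points of the network. -/
noncomputable def weightedDist (η : J → ℝ → ℝ) (x y : EuclideanSpace ℝ (Fin n)) : ℝ :=
  sInf {L | N.IsPathLength η x y L}

/-- The weighted distance `d` from the boundary vertices. -/
noncomputable def bdDist (η : J → ℝ → ℝ) (x : EuclideanSpace ℝ (Fin n)) : ℝ :=
  ⨅ i : N.boundary, N.weightedDist η x (N.vertex i)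

/-! ### Viscosity solutions of the eikonal equation -/

/-- The subsolution test for `|Du| - 1/η = 0` at the points of `A` lying in an open edge. -/
def IsViscSubOn (η : J → ℝ → ℝ) (u : EuclideanSpace ℝ (Fin n) → ℝ)
    (A : Set (EuclideanSpace ℝ (Fin n))) : Prop :=
  ∀ j, ∀ t ∈ Ioo 0 (N.len j), N.param j t ∈ A → ∀ φ, N.IsC1 φ →
    IsLocalMaxOn (fun x => u x - φ x) N.carrier (N.param j t) →
    |deriv (N.proj φ j) t| - 1 / η j t ≤ 0

/-- The supersolution test for `|Du| - 1/η = 0` at the points of `A` lying in an open edge, and at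
the transition vertices lying in `A`. -/
def IsViscSuperOn (η : J → ℝ → ℝ) (u : EuclideanSpace ℝ (Fin n) → ℝ)
    (A : Set (EuclideanSpace ℝ (Fin n))) : Prop :=
  (∀ j, ∀ t ∈ Ioo 0 (N.len j), N.param j t ∈ A → ∀ φ, N.IsC1 φ →
    IsLocalMinOn (fun x => u x - φ x) N.carrier (N.param j t) →
    0 ≤ |deriv (N.proj φ j) t| - 1 / η j t) ∧
  (∀ i, i ∉ N.boundary → N.vertex i ∈ A → ∀ φ, N.IsC1 φ →
    IsLocalMinOn (fun x => u x - φ x) N.carrier (N.vertex i) →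
    ∃ j, N.Incident i j ∧ ∃ p, N.HasOrientedDeriv φ i j p ∧
      0 ≤ |p| - 1 / η j (N.paramInv j (N.vertex i)))

/-- `u` is a viscosity solution of `|Du| - 1/η = 0` in the set `A` of points of the network. -/
def IsViscSolOn (η : J → ℝ → ℝ) (u : EuclideanSpace ℝ (Fin n) → ℝ)
    (A : Set (EuclideanSpace ℝ (Fin n))) : Prop :=
  N.IsCont u ∧ N.IsViscSubOn η u A ∧ N.IsViscSuperOn η u A

/-- The points `x` of the network, boundary vertices excluded, with `v(x) ≠ 0`. At a vertex this
means that the value of `v` along at least one of the incident edges is not zero. -/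
def nonzeroSet (v : J → ℝ → ℝ) : Set (EuclideanSpace ℝ (Fin n)) :=
  {x ∈ N.inner | ∃ j, ∃ t ∈ Icc 0 (N.len j), N.param j t = x ∧ v j t ≠ 0}

/-! ### Solutions of the sandpile system -/

/-- The transmission condition at the transition vertices. -/
def Transmission [Fintype J] (C : I → Finset J → J → ℝ) (u : EuclideanSpace ℝ (Fin n) → ℝ)
    (v : J → ℝ → ℝ) : Prop :=
  ∀ i, i ∉ N.boundary →
    (∀ j, N.Incident i j → ¬ N.SlopeDefined u i j → v j (N.paramInv j (N.vertex i)) = 0) ∧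
    (∀ j ∈ N.incMinus u i, v j (N.paramInv j (N.vertex i)) =
      C i (N.incMinus u i) j * ∑ k ∈ N.incPlus u i, v k (N.paramInv k (N.vertex i)))

/-- `(u, v)` is a solution of the sandpile Monge–Kantorovich system: conservation law in the weak
sense, eikonal equation in the viscosity sense where `v ≠ 0`, gradient bound, boundary and
transmission conditions. `u` is a function on the network, `v` a function on each closed edge. -/
structure IsSandpileSolution [Fintype J] (η f : J → ℝ → ℝ) (C : I → Finset J → J → ℝ)
    (u : EuclideanSpace ℝ (Fin n) → ℝ) (v : J → ℝ → ℝ) : Prop where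
  v_cont : ∀ j, ContinuousOn (v j) (Icc 0 (N.len j))
  v_nonneg : ∀ j, ∀ t ∈ Icc 0 (N.len j), 0 ≤ v j t
  u_cont : N.IsCont u
  u_nonneg : ∀ x ∈ N.carrier, 0 ≤ u x
  u_weak : ∃ Du : J → ℝ → ℝ,
    (∀ j, IsW1InftyWith (N.len j) (N.proj u j) (Du j)) ∧
    (∀ j, ∀ᵐ t ∂(edgeMeasure (N.len j)), η j t * |Du j t| ≤ 1) ∧
    ∀ (ψ : EuclideanSpace ℝ (Fin n) → ℝ) (Dψ : J → ℝ → ℝ), N.IsCont ψ →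
      (∀ j, IsW1InftyWith (N.len j) (N.proj ψ j) (Dψ j)) →
      (∀ i ∈ N.boundary, ψ (N.vertex i) = 0) →
      ∑ j, ∫ t in 0..N.len j, v j t * η j t * Du j t * Dψ j t =
        ∑ j, ∫ t in 0..N.len j, f j t * N.proj ψ j t
  u_visc : N.IsViscSolOn η u (N.nonzeroSet v)
  u_boundary : ∀ i ∈ N.boundary, u (N.vertex i) = 0
  transmission : N.Transmission C u v

/-! ### The singular set, the projections and the representation formula -/

/-- `S_j(u)`: the points of the open edge `j` where `u_j` is not differentiable. -/
def singEdge (u : EuclideanSpace ℝ (Fin n) → ℝ) (j : J) : Set ℝ :=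
  {t ∈ Ioo 0 (N.len j) | ¬ DifferentiableAt ℝ (N.proj u j) t}

/-- The singular set `S(u)`: interior singular points, and vertices at which `u` has a local
maximum on the network. -/
def singSet (u : EuclideanSpace ℝ (Fin n) → ℝ) : Set (EuclideanSpace ℝ (Fin n)) :=
  (⋃ j, N.param j '' N.singEdge u j) ∪
    {x | ∃ i, x = N.vertex i ∧ IsLocalMaxOn u N.carrier (N.vertex i)}

/-- `T_j(u)`: the parameters of the end points from which `u` leaves downhill along the edge. -/
def topEnd [Fintype J] (u : EuclideanSpace ℝ (Fin n) → ℝ) (j : J) : Set ℝ :=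
  {t | ∃ i, j ∈ N.incMinus u i ∧ t = N.paramInv j (N.vertex i)}

/-- The projection set `Σ_j(u) = S_j(u) ∪ T_j(u)`. -/
def projSet [Fintype J] (u : EuclideanSpace ℝ (Fin n) → ℝ) (j : J) : Set ℝ :=
  N.singEdge u j ∪ N.topEnd u j

/-- `u_j'(t)` on the closed interval `[0, len j]`, one-sided at the end points. (At the points of
`S_j(u)`, where it does not exist, its value is `0`.) -/
noncomputable def edgeDeriv (u : EuclideanSpace ℝ (Fin n) → ℝ) (j : J) (t : ℝ) : ℝ :=
  derivWithin (N.proj u j) (Icc 0 (N.len j)) t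

/-- The `s ≥ 0` for which `t + s η_j(t) d_j'(t)` lies in the projection set. -/
def hitTimes [Fintype J] (η : J → ℝ → ℝ) (j : J) (t : ℝ) : Set ℝ :=
  {s | 0 ≤ s ∧ t + s * (η j t * N.edgeDeriv (N.bdDist η) j t) ∈ N.projSet (N.bdDist η) j}

/-- `τ_j(t)`, the smallest element of `hitTimes`. -/
noncomputable def tau [Fintype J] (η : J → ℝ → ℝ) (j : J) (t : ℝ) : ℝ :=
  sInf (N.hitTimes η j t)

/-- The projection `P_j(t) = t + τ_j(t) η_j(t) d_j'(t)`. -/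
noncomputable def projPt [Fintype J] (η : J → ℝ → ℝ) (j : J) (t : ℝ) : ℝ :=
  t + N.tau η j t * (η j t * N.edgeDeriv (N.bdDist η) j t)

open Classical in
/-- The representation formula: `v_j(t)` is the integral of the source from `t` to `P_j(t)` plus, if
`P_j(t) ∈ T_j(d)`, the part `C_{ij} ∑_{k ∈ Inc_i^+(d)} v_k(x_i)` of the mass coming into the vertex
`x_i = π_j(P_j(t))`. (The sum over `i` has exactly one term in this case.) -/
def Represents [Fintype I] [Fintype J] (η f : J → ℝ → ℝ) (C : I → Finset J → J → ℝ)
    (v : J → ℝ → ℝ) : Prop :=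
  ∀ j, ∀ t ∈ Icc 0 (N.len j),
    v j t =
      (∫ r in 0..N.tau η j t, f j (t + r * (η j t * N.edgeDeriv (N.bdDist η) j t))) +
      (N.topEnd (N.bdDist η) j).indicator
        (fun p => ∑ i with N.vertex i = N.param j p,
          C i (N.incMinus (N.bdDist η) i) j *
            ∑ k ∈ N.incPlus (N.bdDist η) i, v k (N.paramInv k (N.vertex i)))
        (N.projPt η j t)

/-- The flux `v η d'` along the edge `j`. -/
noncomputable def flux (η : J → ℝ → ℝ) (v : J → ℝ → ℝ) (j : J) (t : ℝ) : ℝ :=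
  v j t * η j t * N.edgeDeriv (N.bdDist η) j t

end

end Network

/-! ### Primitives of bounded functions on an interval -/

/-! Everything rests on the shape of `d` along one edge. A path to the boundary that starts inside
an edge leaves it through an end point, so on the edge `d` is the minimum of two functions, one
rising and one falling at unit rate in weighted arc length `g`. Hence `d = d(p) - |g - g(p)|` for a
single point `p`, the top of the edge (`exists_edge_top`), and `d` is strictly smaller elsewhere on
the edge (`bdDist_param_lt`). Either `p` is interior, and is then the only kink of `d`, or it is an
end point, and is then the only downhill end; so the projection set is `{p}`. Away from `p` one has
`η d' = 1` or `-1`, so `τ` is the parameter distance to `p` and the projection is `p` itself.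

The representation formula therefore reads: `v` is the mass of `f` between `t` and the top, plus a
constant depending only on the inflows at the vertices (`represents_iff`). The inflows solve a
finite linear system in which the inflow at a vertex depends only on those at vertices with strictly
larger `d`. Recursion from the highest vertices downwards gives existence, uniqueness and
nonnegativity (`exists_solution_of_triangular`, `exists_inflow`).

The flux `v η d'` is a primitive of `-f` on the whole edge, even across an interior top, because `v`
vanishes there (`Represents.flux_sub`). This yields the pointwise conservation law. Integration by
parts yields the weak one: the end point terms regroup by vertices, where they cancel because the
coefficients sum to one (`Represents.kirchhoff`) or because the test function vanishes. The
cancellation needs a downhill edge at each transition vertex, which exists since a shortest route to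
the boundary has to leave the vertex along some edge (`exists_incident_top`). The same edge supplies
the supersolution test at the vertex. Inside an edge the eikonal equation could fail only at the
kink, where `v = 0`. -/

theorem intervalIntegrable_of_memLp_edgeMeasure {L : ℝ} {g : ℝ → ℝ}
    (hg : MemLp g ⊤ (edgeMeasure L)) {a b : ℝ} (ha : a ∈ Icc 0 L) (hb : b ∈ Icc 0 L) :
    IntervalIntegrable g volume a b := by
  have : IsFiniteMeasure (edgeMeasure L) := by
    unfold edgeMeasure
    exact ⟨by simp⟩
  have h1 : IntegrableOn g (Ioo 0 L) := hg.integrable le_top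
  rw [← integrableOn_Icc_iff_integrableOn_Ioo] at h1
  rw [intervalIntegrable_iff]
  refine h1.mono_set (uIoc_subset_uIcc.trans ?_)
  exact (convex_Icc (0 : ℝ) L).ordConnected.uIcc_subset ha hb

theorem absolutelyContinuousOnInterval_const_add_primitive {L : ℝ} {g : ℝ → ℝ} (c : ℝ)
    (hg : IntervalIntegrable g volume 0 L) :
    AbsolutelyContinuousOnInterval (fun t => c + ∫ r in 0..t, g r) 0 L := by
  have h1 : AbsolutelyContinuousOnInterval (fun _ : ℝ => c) 0 L :=
    ((LipschitzWith.const c).lipschitzOnWith (s := uIcc 0 L)).absolutelyContinuousOnInterval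
  exact h1.add (hg.absolutelyContinuousOnInterval_intervalIntegral (by simp))

/-- Integration by parts for two primitives. -/
theorem integral_mul_of_primitive {L : ℝ} (hL : 0 ≤ L) {G g H h : ℝ → ℝ}
    (hg : IntervalIntegrable g volume 0 L) (hh : IntervalIntegrable h volume 0 L)
    (hG : ∀ t ∈ Icc 0 L, G t = G 0 + ∫ r in 0..t, g r)
    (hH : ∀ t ∈ Icc 0 L, H t = H 0 + ∫ r in 0..t, h r) :
    ∫ t in 0..L, G t * h t = G L * H L - G 0 * H 0 - ∫ t in 0..L, g t * H t := by
  have aG := absolutelyContinuousOnInterval_const_add_primitive (G 0) hg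
  have aH := absolutelyContinuousOnInterval_const_add_primitive (H 0) hh
  have key := aG.integral_mul_deriv_eq_deriv_mul aH
  have sub : ∀ x ∈ uIoc (0 : ℝ) L, x ∈ Icc 0 L := fun x hx => by
    rw [uIoc_of_le hL] at hx; exact Ioc_subset_Icc_self hx
  have e1 : ∫ t in 0..L, G t * h t = ∫ t in 0..L, (G 0 + ∫ r in 0..t, g r) *
      deriv (fun t => H 0 + ∫ r in 0..t, h r) t := by
    apply intervalIntegral.integral_congr_ae
    filter_upwards [hh.ae_hasDerivAt_integral] with x hx hx'
    rw [((hx (uIoc_subset_uIcc hx') 0 (by simp)).const_add _).deriv, ← hG x (sub x hx')]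
  have e2 : ∫ t in 0..L, g t * H t = ∫ t in 0..L, deriv (fun t => G 0 + ∫ r in 0..t, g r) t *
      (H 0 + ∫ r in 0..t, h r) := by
    apply intervalIntegral.integral_congr_ae
    filter_upwards [hg.ae_hasDerivAt_integral] with x hx hx'
    rw [((hx (uIoc_subset_uIcc hx') 0 (by simp)).const_add _).deriv, ← hH x (sub x hx')]
  rw [e1, e2, key, ← hG L ⟨hL, le_rfl⟩, ← hH L ⟨hL, le_rfl⟩]
  simp

theorem continuousOn_of_primitive {L : ℝ} (hL : 0 ≤ L) {G g : ℝ → ℝ}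
    (hg : IntervalIntegrable g volume 0 L)
    (hG : ∀ t ∈ Icc 0 L, G t = G 0 + ∫ r in 0..t, g r) : ContinuousOn G (Icc 0 L) := by
  have := (absolutelyContinuousOnInterval_const_add_primitive (G 0) hg).continuousOn
  rw [uIcc_of_le hL] at this
  exact this.congr hG

theorem test_function_eq_primitive {φ : ℝ → ℝ} (hφ : ContDiff ℝ ∞ φ) (t : ℝ) :
    φ t = φ 0 + ∫ r in 0..t, deriv φ r := by
  have hc : Continuous (deriv φ) := hφ.continuous_deriv (by simp)
  rw [intervalIntegral.integral_deriv_eq_sub (fun x _ => (hφ.differentiable (by simp)) x)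
    (hc.intervalIntegrable _ _)]
  ring

theorem eq_zero_of_tsupport_subset_Ioo {L : ℝ} {φ : ℝ → ℝ} (hs : tsupport φ ⊆ Ioo 0 L) :
    φ 0 = 0 ∧ φ L = 0 := by
  constructor
  · exact image_eq_zero_of_notMem_tsupport fun h => lt_irrefl _ (hs h).1
  · exact image_eq_zero_of_notMem_tsupport fun h => lt_irrefl _ (hs h).2

theorem isW1InftyWith_of_primitive {L : ℝ} (hL : 0 ≤ L) {G g : ℝ → ℝ}
    (hg : MemLp g ⊤ (edgeMeasure L))
    (hG : ∀ t ∈ Icc 0 L, G t = G 0 + ∫ r in 0..t, g r) : IsW1InftyWith L G g := by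
  have hgi := intervalIntegrable_of_memLp_edgeMeasure hg (left_mem_Icc.2 hL) (right_mem_Icc.2 hL)
  have hc := continuousOn_of_primitive hL hgi hG
  refine ⟨?_, hg, ?_⟩
  · obtain ⟨C, hC⟩ := isCompact_Icc.exists_bound_of_continuousOn hc
    refine memLp_top_of_bound
      ((hc.mono Ioo_subset_Icc_self).aestronglyMeasurable measurableSet_Ioo) C ?_
    exact (ae_restrict_iff' measurableSet_Ioo).2
      (Eventually.of_forall fun x hx => hC x (Ioo_subset_Icc_self hx))
  · intro φ hφ _ hs
    have hc' : Continuous (deriv φ) := hφ.continuous_deriv (by simp)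
    rw [integral_mul_of_primitive hL hgi (hc'.intervalIntegrable _ _) hG
      (fun t _ => test_function_eq_primitive hφ t)]
    simp [eq_zero_of_tsupport_subset_Ioo hs]

theorem contDiff_primitive {w : ℝ → ℝ} (hw : ContDiff ℝ ∞ w) :
    ContDiff ℝ ∞ (fun t => ∫ r in 0..t, w r) := by
  have hd : ∀ t, HasDerivAt (fun t => ∫ r in 0..t, w r) (w t) t := fun t =>
    intervalIntegral.integral_hasDerivAt_right (hw.continuous.intervalIntegrable _ _)
      hw.continuous.stronglyMeasurable.stronglyMeasurableAtFilter
      hw.continuous.continuousAt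
  rw [contDiff_infty_iff_deriv]
  refine ⟨fun t => (hd t).differentiableAt, ?_⟩
  rwa [show deriv (fun t => ∫ r in 0..t, w r) = w from funext fun t => (hd t).deriv]

/-- A test function of mean zero is the derivative of a test function. -/
theorem tsupport_primitive_subset {L : ℝ} {w : ℝ → ℝ} (hw : ContDiff ℝ ∞ w)
    (hK : HasCompactSupport w) (hs : tsupport w ⊆ Ioo 0 L) (h0 : ∫ r in 0..L, w r = 0) :
    HasCompactSupport (fun t => ∫ r in 0..t, w r) ∧
      tsupport (fun t => ∫ r in 0..t, w r) ⊆ Ioo 0 L := by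
  rcases (tsupport w).eq_empty_or_nonempty with he | hne
  · have : w = 0 := tsupport_eq_empty_iff.1 he
    subst this
    have h2 : (fun t => ∫ r in (0 : ℝ)..t, (0 : ℝ → ℝ) r) = 0 := by ext; simp
    rw [h2]
    exact ⟨HasCompactSupport.zero, by simp [tsupport]⟩
  obtain ⟨a, ha, ha'⟩ := hK.isCompact.exists_isLeast hne
  obtain ⟨b, hb, hb'⟩ := hK.isCompact.exists_isGreatest hne
  have hz : ∀ r, r ∉ Icc a b → w r = 0 := fun r hr =>
    image_eq_zero_of_notMem_tsupport fun h => hr ⟨ha' h, hb' h⟩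
  have h1 : ∀ t, t ∉ Icc a b → ∫ r in 0..t, w r = 0 := by
    intro t ht
    rcases lt_or_ge t a with h | h
    · rw [intervalIntegral.integral_congr (g := fun _ => 0), intervalIntegral.integral_zero]
      intro r hr
      refine hz r fun h' => ?_
      have := (hs ha).1
      rcases mem_uIcc.1 hr with h2 | h2 <;> linarith [h'.1, h2.1, h2.2]
    · have hbt : b < t := by
        by_contra h'
        exact ht ⟨h, not_lt.1 h'⟩
      -- Beyond `b` the integral up to `t` is the total mean, which is zero, plus a piece between
      -- `L` and `t` on which `w` vanishes, in whichever order `L` and `t` lie.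
      have h2 := intervalIntegral.integral_add_adjacent_intervals (μ := volume)
        (hw.continuous.intervalIntegrable 0 L) (hw.continuous.intervalIntegrable L t)
      rw [← h2, h0, zero_add,
        intervalIntegral.integral_congr (g := fun _ => 0), intervalIntegral.integral_zero]
      intro r hr
      refine hz r fun h' => ?_
      have := (hs hb).2
      rcases mem_uIcc.1 hr with h2 | h2 <;> linarith [h'.2, h2.1, h2.2]
  have hsub : tsupport (fun t => ∫ r in 0..t, w r) ⊆ Icc a b := by
    refine closure_minimal (fun t ht => ?_) isClosed_Icc
    by_contra h
    exact ht (h1 t h)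
  refine ⟨HasCompactSupport.of_support_subset_isCompact isCompact_Icc
    (subset_closure.trans hsub), hsub.trans (Icc_subset_Ioo (hs ha).1 (hs hb).2)⟩

/-- The lemma of du Bois-Reymond. -/
theorem exists_const_of_hasWeakDeriv_zero {L : ℝ} (hL : 0 < L) {h : ℝ → ℝ}
    (hc : ContinuousOn h (Icc 0 L)) (hw : HasWeakDeriv L h 0) :
    ∃ c, ∀ t ∈ Icc 0 L, h t = c := by
  -- The outer radius `L / 4` keeps the support of the bump inside the open interval.
  let ρb : ContDiffBump (L / 2) := ⟨L / 8, L / 4, by linarith, by linarith⟩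
  let ρ : ℝ → ℝ := ρb.normed volume
  have ρs : ContDiff ℝ ∞ ρ := ρb.contDiff_normed
  have ρK : HasCompactSupport ρ := ρb.hasCompactSupport_normed
  have ρt : tsupport ρ ⊆ Ioo 0 L := by
    rw [show tsupport ρ = _ from ρb.tsupport_normed_eq (μ := volume), Real.closedBall_eq_Icc]
    apply Icc_subset_Ioo <;> simp only [ρb] <;> linarith
  have toInt : ∀ g : ℝ → ℝ, tsupport g ⊆ Ioo 0 L → ∫ r in 0..L, g r = ∫ r, g r := by
    intro g hg
    apply intervalIntegral.integral_eq_integral_of_support_subset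
    exact (subset_closure.trans hg).trans Ioo_subset_Ioc_self
  have ρ1 : ∫ r in 0..L, ρ r = 1 := by
    rw [toInt ρ ρt]; exact ρb.integral_normed
  have hi : ∀ g : ℝ → ℝ, Continuous g → IntervalIntegrable (fun t => h t * g t) volume 0 L := by
    intro g hg
    apply ContinuousOn.intervalIntegrable
    rw [uIcc_of_le hL.le]
    exact hc.mul hg.continuousOn
  set c := ∫ r in 0..L, h r * ρ r with hcdef
  have key : ∀ w : ℝ → ℝ, ContDiff ℝ ∞ w → HasCompactSupport w → tsupport w ⊆ Ioo 0 L →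
      ∫ t, w t • (h t - c) = 0 := by
    intro w ws wK wt
    set m := ∫ r in 0..L, w r with hm
    -- Subtracting `m ρ` makes the mean zero, so that `w1` is the derivative of a test function and
    -- the hypothesis applies to its primitive.
    let w1 : ℝ → ℝ := fun t => w t - m * ρ t
    have w1s : ContDiff ℝ ∞ w1 := ws.sub (contDiff_const.mul ρs)
    have w1t : tsupport w1 ⊆ tsupport w ∪ tsupport ρ := by
      refine closure_minimal (fun t ht => ?_)
        ((isClosed_tsupport _).union (isClosed_tsupport _))
      by_contra h'
      rw [mem_union, not_or] at h'
      apply ht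
      simp only [w1]
      rw [image_eq_zero_of_notMem_tsupport h'.1, image_eq_zero_of_notMem_tsupport h'.2]
      simp
    have w1K : HasCompactSupport w1 :=
      (wK.isCompact.union ρK.isCompact).of_isClosed_subset (isClosed_tsupport _) w1t
    have w10 : ∫ r in 0..L, w1 r = 0 := by
      simp only [w1]
      rw [intervalIntegral.integral_sub (ws.continuous.intervalIntegrable _ _)
        ((ρs.continuous.intervalIntegrable _ _).const_mul m),
        intervalIntegral.integral_const_mul, ρ1]
      simp [hm]
    obtain ⟨pK, pt⟩ := tsupport_primitive_subset w1s w1K (w1t.trans (union_subset wt ρt)) w10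
    have hp := hw _ (contDiff_primitive w1s) pK pt
    have hd : deriv (fun t => ∫ r in 0..t, w1 r) = w1 := funext fun t =>
      (intervalIntegral.integral_hasDerivAt_right (w1s.continuous.intervalIntegrable _ _)
      w1s.continuous.stronglyMeasurable.stronglyMeasurableAtFilter
      w1s.continuous.continuousAt).deriv
    rw [hd] at hp
    simp only [Pi.zero_apply, zero_mul, intervalIntegral.integral_zero, neg_zero] at hp
    rw [← toInt]
    · have e1 : ∀ t, h t * w1 t = h t * w t - m * (h t * ρ t) := fun t => by
        simp only [w1]; ring
      simp only [e1] at hp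
      rw [intervalIntegral.integral_sub (hi w ws.continuous)
        ((hi ρ ρs.continuous).const_mul m), intervalIntegral.integral_const_mul, ← hcdef] at hp
      have e2 : ∀ t, w t • (h t - c) = h t * w t - c * w t := fun t => by
        simp only [smul_eq_mul]; ring
      simp only [e2]
      rw [intervalIntegral.integral_sub (hi w ws.continuous)
        ((ws.continuous.intervalIntegrable _ _).const_mul c), intervalIntegral.integral_const_mul,
        ← hm]
      linarith
    · exact (tsupport_smul_subset_left w _).trans wt
  have hae : ∀ᵐ t, t ∈ Ioo 0 L → h t - c = 0 := by
    refine isOpen_Ioo.ae_eq_zero_of_integral_contDiff_smul_eq_zero ?_ key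
    exact ((hc.sub continuousOn_const).mono Ioo_subset_Icc_self).locallyIntegrableOn
      measurableSet_Ioo
  refine ⟨c, ?_⟩
  have h1 : h =ᵐ[volume.restrict (Icc 0 L)] fun _ => c := by
    rw [← restrict_Ioo_eq_restrict_Icc]
    refine (ae_restrict_iff' measurableSet_Ioo).2 ?_
    filter_upwards [hae] with t ht ht'
    linarith [ht ht']
  exact Measure.eqOn_Icc_of_ae_eq volume hL.ne h1 hc continuousOn_const

/-- A continuous function is the primitive of its bounded weak derivative. -/
theorem eq_primitive_of_isW1InftyWith {L : ℝ} (hL : 0 < L) {ψ ψ' : ℝ → ℝ}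
    (hc : ContinuousOn ψ (Icc 0 L)) (hψ : IsW1InftyWith L ψ ψ') :
    ∀ t ∈ Icc 0 L, ψ t = ψ 0 + ∫ r in 0..t, ψ' r := by
  have hi := intervalIntegrable_of_memLp_edgeMeasure hψ.2.1 (left_mem_Icc.2 hL.le)
    (right_mem_Icc.2 hL.le)
  let G : ℝ → ℝ := fun t => ∫ r in 0..t, ψ' r
  have hG : ∀ t ∈ Icc 0 L, G t = G 0 + ∫ r in 0..t, ψ' r := fun t _ => by simp [G]
  have hGc := continuousOn_of_primitive hL.le hi hG
  have hGw := (isW1InftyWith_of_primitive hL.le hψ.2.1 hG).2.2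
  obtain ⟨c, hc⟩ := exists_const_of_hasWeakDeriv_zero (h := fun t => ψ t - G t) hL
    (hc.sub hGc) (by
      intro φ h1 h2 h3
      have hcd : Continuous (deriv φ) := h1.continuous_deriv (by simp)
      simp only [sub_mul]
      rw [intervalIntegral.integral_sub, hψ.2.2 φ h1 h2 h3, hGw φ h1 h2 h3]
      · simp
      · apply ContinuousOn.intervalIntegrable
        rw [uIcc_of_le hL.le]
        exact hc.mul hcd.continuousOn
      · apply ContinuousOn.intervalIntegrable
        rw [uIcc_of_le hL.le]
        exact hGc.mul hcd.continuousOn)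
  intro t ht
  have h1 := hc t ht
  have h2 := hc 0 (left_mem_Icc.2 hL.le)
  simp only [G, intervalIntegral.integral_same] at h1 h2
  linarith

/-! ### Weighted arc length on an interval -/

/-- The weighted length of the initial piece of an edge. -/
noncomputable def arcLength (e : ℝ → ℝ) (t : ℝ) : ℝ := ∫ r in 0..t, 1 / e r

section arcLength

variable {L : ℝ} {e : ℝ → ℝ}

theorem continuousOn_one_div (hc : ContinuousOn e (Icc 0 L)) (hp : ∀ t ∈ Icc 0 L, 0 < e t) :
    ContinuousOn (fun r => 1 / e r) (Icc 0 L) :=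
  continuousOn_const.div hc fun t ht => (hp t ht).ne'

theorem intervalIntegrable_one_div (hc : ContinuousOn e (Icc 0 L))
    (hp : ∀ t ∈ Icc 0 L, 0 < e t) {s t : ℝ} (hs : s ∈ Icc 0 L) (ht : t ∈ Icc 0 L) :
    IntervalIntegrable (fun r => 1 / e r) volume s t :=
  ((continuousOn_one_div hc hp).mono
    ((convex_Icc (0 : ℝ) L).ordConnected.uIcc_subset hs ht)).intervalIntegrable

theorem integral_one_div_eq_arcLength_sub (hc : ContinuousOn e (Icc 0 L))
    (hp : ∀ t ∈ Icc 0 L, 0 < e t) {s t : ℝ} (hs : s ∈ Icc 0 L) (ht : t ∈ Icc 0 L) :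
    ∫ r in s..t, 1 / e r = arcLength e t - arcLength e s := by
  have h0 : (0 : ℝ) ∈ Icc 0 L := ⟨le_rfl, hs.1.trans hs.2⟩
  exact (intervalIntegral.integral_interval_sub_left (intervalIntegrable_one_div hc hp h0 ht)
    (intervalIntegrable_one_div hc hp h0 hs)).symm

theorem hasDerivWithinAt_arcLength (hc : ContinuousOn e (Icc 0 L))
    (hp : ∀ t ∈ Icc 0 L, 0 < e t) {t : ℝ} (ht : t ∈ Icc 0 L) :
    HasDerivWithinAt (arcLength e) (1 / e t) (Icc 0 L) t := by
  have hL : 0 ≤ L := ht.1.trans ht.2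
  have hd := continuousOn_one_div hc hp
  -- Nothing is known of `e` outside the interval. A continuous extension of `1 / e` makes the
  -- fundamental theorem applicable at the end points too.
  let h : ℝ → ℝ := IccExtend hL ((Icc 0 L).domRestrict fun r => 1 / e r)
  have hh : Continuous h := Continuous.Icc_extend' (continuousOn_iff_continuous_domRestrict.1 hd)
  have heq : ∀ r ∈ Icc 0 L, h r = 1 / e r := fun r hr => IccExtend_of_mem _ _ hr
  have h1 : HasDerivAt (fun t => ∫ r in 0..t, h r) (h t) t :=
    intervalIntegral.integral_hasDerivAt_right (hh.intervalIntegrable _ _)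
      hh.stronglyMeasurable.stronglyMeasurableAtFilter hh.continuousAt
  have h2 : ∀ s ∈ Icc 0 L, arcLength e s = ∫ r in 0..s, h r := fun s hs =>
    intervalIntegral.integral_congr fun r hr => (heq r
      ((convex_Icc (0 : ℝ) L).ordConnected.uIcc_subset (left_mem_Icc.2 hL) hs hr)).symm
  rw [← heq t ht]
  exact h1.hasDerivWithinAt.congr h2 (h2 t ht)

theorem continuousOn_arcLength (hc : ContinuousOn e (Icc 0 L))
    (hp : ∀ t ∈ Icc 0 L, 0 < e t) : ContinuousOn (arcLength e) (Icc 0 L) :=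
  fun _ ht => (hasDerivWithinAt_arcLength hc hp ht).continuousWithinAt

theorem strictMonoOn_arcLength (hc : ContinuousOn e (Icc 0 L))
    (hp : ∀ t ∈ Icc 0 L, 0 < e t) : StrictMonoOn (arcLength e) (Icc 0 L) := by
  intro s hs t ht hst
  rw [← sub_pos, ← integral_one_div_eq_arcLength_sub hc hp hs ht]
  refine intervalIntegral.intervalIntegral_pos_of_pos_on
    (intervalIntegrable_one_div hc hp hs ht) (fun x hx => ?_) hst
  exact one_div_pos.2 (hp x ⟨hs.1.trans hx.1.le, hx.2.le.trans ht.2⟩)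

end arcLength

namespace Network

variable {n : ℕ} {I J : Type*} {N : Network n I J} {η : J → ℝ → ℝ}

theorem zero_mem (N : Network n I J) (j : J) : (0 : ℝ) ∈ Icc 0 (N.len j) :=
  left_mem_Icc.2 (N.len_pos j).le

theorem len_mem (N : Network n I J) (j : J) : N.len j ∈ Icc 0 (N.len j) :=
  right_mem_Icc.2 (N.len_pos j).le

/-! ### Vertices and edges -/

theorem paramInv_param {j : J} {t : ℝ} (ht : t ∈ Icc 0 (N.len j)) :
    N.paramInv j (N.param j t) = t :=
  (N.param_injOn j).leftInvOn_invFunOn ht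

/-- The vertex at the parameter `0`. -/
noncomputable def src (N : Network n I J) (j : J) : I := (N.param_zero j).choose

/-- The vertex at the parameter `len j`. -/
noncomputable def tgt (N : Network n I J) (j : J) : I := (N.param_len j).choose

theorem param_src (j : J) : N.param j 0 = N.vertex (N.src j) := (N.param_zero j).choose_spec

theorem param_tgt (j : J) : N.param j (N.len j) = N.vertex (N.tgt j) :=
  (N.param_len j).choose_spec

theorem src_ne_tgt (j : J) : N.src j ≠ N.tgt j := by
  intro h
  have h1 : N.param j 0 = N.param j (N.len j) := by rw [param_src, param_tgt, h]
  exact (N.len_pos j).ne (N.param_injOn j (N.zero_mem j) (N.len_mem j) h1)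

theorem eq_zero_or_len_of_notMem_Ioo {j : J} {t : ℝ} (ht : t ∈ Icc 0 (N.len j))
    (h : t ∉ Ioo 0 (N.len j)) : t = 0 ∨ t = N.len j := by
  by_contra! h'
  exact h ⟨lt_of_le_of_ne ht.1 h'.1.symm, lt_of_le_of_ne ht.2 h'.2⟩

theorem eq_zero_or_len_of_param_eq_vertex {j : J} {t : ℝ} (ht : t ∈ Icc 0 (N.len j)) {i : I}
    (h : N.param j t = N.vertex i) : t = 0 ∨ t = N.len j :=
  eq_zero_or_len_of_notMem_Ioo ht fun h' => N.vertex_not_interior j t h' i h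

theorem incident_iff {i : I} {j : J} : N.Incident i j ↔ i = N.src j ∨ i = N.tgt j := by
  constructor
  · rintro ⟨t, ht, h⟩
    rcases eq_zero_or_len_of_param_eq_vertex ht h with rfl | rfl
    · left; exact N.vertex_injective (by rw [← h, param_src])
    · right; exact N.vertex_injective (by rw [← h, param_tgt])
  · rintro (rfl | rfl)
    · exact ⟨0, N.zero_mem j, param_src j⟩
    · exact ⟨N.len j, N.len_mem j, param_tgt j⟩

theorem incident_src (j : J) : N.Incident (N.src j) j := incident_iff.2 (Or.inl rfl)

theorem incident_tgt (j : J) : N.Incident (N.tgt j) j := incident_iff.2 (Or.inr rfl)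

theorem paramInv_src (j : J) : N.paramInv j (N.vertex (N.src j)) = 0 := by
  rw [← param_src, paramInv_param (N.zero_mem j)]

theorem paramInv_tgt (j : J) : N.paramInv j (N.vertex (N.tgt j)) = N.len j := by
  rw [← param_tgt, paramInv_param (N.len_mem j)]

theorem paramInv_mem {i : I} {j : J} (h : N.Incident i j) :
    N.paramInv j (N.vertex i) ∈ Icc 0 (N.len j) := by
  rcases incident_iff.1 h with rfl | rfl
  · rw [paramInv_src]; exact N.zero_mem j
  · rw [paramInv_tgt]; exact N.len_mem j

theorem param_paramInv {i : I} {j : J} (h : N.Incident i j) :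
    N.param j (N.paramInv j (N.vertex i)) = N.vertex i := by
  rcases incident_iff.1 h with rfl | rfl
  · rw [paramInv_src, param_src]
  · rw [paramInv_tgt, param_tgt]

/-- An interior point of an edge lies on no other edge. -/
theorem eq_of_param_eq {j k : J} {s t : ℝ} (hs : s ∈ Ioo 0 (N.len j)) (ht : t ∈ Icc 0 (N.len k))
    (h : N.param j s = N.param k t) : j = k ∧ s = t := by
  by_cases ht' : t ∈ Ioo 0 (N.len k)
  · obtain rfl := N.edges_disjoint j k s hs t ht' h
    exact ⟨rfl, N.param_injOn j (Ioo_subset_Icc_self hs) ht h⟩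
  · exfalso
    rcases eq_zero_or_len_of_notMem_Ioo ht ht' with rfl | rfl
    · exact N.vertex_not_interior j s hs _ (h.trans (param_src k))
    · exact N.vertex_not_interior j s hs _ (h.trans (param_tgt k))

/-- The edge `j₀` excludes a network consisting of a single vertex. A chain from `i` to the source
of `j₀` either begins with an edge at `i` or is trivial, and then `i` is that source. -/
theorem exists_incident (N : Network n I J) (j₀ : J) (i : I) : ∃ j, N.Incident i j := by
  have h : ∀ i', Relation.ReflTransGen
    (fun a b => ∃ j, N.vertex a ∈ N.param j '' Icc 0 (N.len j) ∧
      N.vertex b ∈ N.param j '' Icc 0 (N.len j)) i i' → i' = i ∨ ∃ j, N.Incident i j := by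
    intro i' h
    rcases h.cases_head with h | ⟨b, ⟨j, hj, _⟩, _⟩
    · exact Or.inl h.symm
    · exact Or.inr ⟨j, hj⟩
  rcases h _ (N.connected i (N.src j₀)) with h1 | h1
  · exact ⟨j₀, h1 ▸ incident_src j₀⟩
  · exact h1

/-! ### The distance from the boundary -/

theorem IsPathLength.nonneg {x y : EuclideanSpace ℝ (Fin n)} {Λ : ℝ}
    (h : N.IsPathLength η x y Λ) : 0 ≤ Λ := by
  induction h with
  | single => exact abs_nonneg _
  | cons j s t hs ht i hi y L h ih => exact add_nonneg (abs_nonneg _) ih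

/-- A path has at least one piece, so the trivial path is a degenerate piece of an incident edge;
this is the role of `hj`. -/
theorem exists_isPathLength_vertex {i i' : I} {j₀ : J} (hj : N.Incident i j₀) :
    ∃ Λ, N.IsPathLength η (N.vertex i) (N.vertex i') Λ := by
  have h := N.connected i i'
  induction h using Relation.ReflTransGen.head_induction_on generalizing j₀ with
  | refl =>
    obtain ⟨t, ht, h⟩ := hj
    exact ⟨_, h ▸ IsPathLength.single j₀ t t ht ht⟩
  | head h1 _ ih =>
    obtain ⟨j, ⟨s, hs, h2⟩, h3⟩ := h1
    obtain ⟨Λ, hΛ⟩ := ih h3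
    obtain ⟨t, ht, h4⟩ := h3
    exact ⟨_, h2 ▸ IsPathLength.cons j s t hs ht _ h4 _ _ hΛ⟩

theorem exists_isPathLength {j : J} {t : ℝ} (ht : t ∈ Icc 0 (N.len j)) (i' : I) :
    ∃ Λ, N.IsPathLength η (N.param j t) (N.vertex i') Λ := by
  obtain ⟨Λ, hΛ⟩ := exists_isPathLength_vertex (N := N) (η := η) (i' := i') (incident_src j)
  exact ⟨_, IsPathLength.cons j t 0 ht (N.zero_mem j) _ (param_src j) _ _ hΛ⟩

theorem weightedDist_nonneg (x y : EuclideanSpace ℝ (Fin n)) : 0 ≤ N.weightedDist η x y :=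
  Real.sInf_nonneg fun _ h => IsPathLength.nonneg h

theorem bdDist_nonneg (x : EuclideanSpace ℝ (Fin n)) : 0 ≤ N.bdDist η x :=
  Real.iInf_nonneg fun _ => weightedDist_nonneg _ _

theorem bdDist_le {x : EuclideanSpace ℝ (Fin n)} {b : I} (hb : b ∈ N.boundary) {Λ : ℝ}
    (h : N.IsPathLength η x (N.vertex b) Λ) : N.bdDist η x ≤ Λ := by
  refine (ciInf_le ⟨0, ?_⟩ (⟨b, hb⟩ : N.boundary)).trans (csInf_le ⟨0, ?_⟩ h)
  · rintro _ ⟨i, rfl⟩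
    exact weightedDist_nonneg _ _
  · exact fun _ h => IsPathLength.nonneg h

/-- A lower bound for all path lengths passes to the infimum only because paths exist: the real
infimum of the empty set is `0`. -/
theorem le_bdDist {j : J} {t : ℝ} (ht : t ∈ Icc 0 (N.len j)) {c : ℝ}
    (h : ∀ b ∈ N.boundary, ∀ Λ, N.IsPathLength η (N.param j t) (N.vertex b) Λ → c ≤ Λ) :
    c ≤ N.bdDist η (N.param j t) := by
  have : Nonempty N.boundary := N.boundary_nonempty.to_subtype
  refine le_ciInf fun b => le_csInf ?_ fun Λ hΛ => h b b.2 Λ hΛ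
  exact exists_isPathLength ht _

theorem bdDist_boundary {i : I} {j : J} (hij : N.Incident i j) (hi : i ∈ N.boundary) :
    N.bdDist η (N.vertex i) = 0 := by
  refine le_antisymm ?_ (bdDist_nonneg _)
  obtain ⟨t, ht, h⟩ := hij
  have h1 := IsPathLength.single (N := N) (η := η) j t t ht ht
  rw [h, intervalIntegral.integral_same, abs_zero] at h1
  exact bdDist_le hi h1

theorem bdDist_le_add {j : J} {s t : ℝ} (hs : s ∈ Icc 0 (N.len j)) (ht : t ∈ Icc 0 (N.len j))
    {i : I} (hi : N.param j t = N.vertex i) :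
    N.bdDist η (N.param j s) ≤ |∫ r in s..t, 1 / η j r| + N.bdDist η (N.param j t) := by
  rw [← sub_le_iff_le_add']
  refine le_bdDist ht fun b hb Λ hΛ => ?_
  rw [sub_le_iff_le_add']
  rw [hi] at hΛ
  exact bdDist_le hb (IsPathLength.cons j s t hs ht i hi _ _ hΛ)

/-- A path to the boundary leaves an edge through one of its end points. -/
theorem exists_end_le_of_isPathLength {x : EuclideanSpace ℝ (Fin n)} {b : I}
    (hb : b ∈ N.boundary) {Λ : ℝ} (h : N.IsPathLength η x (N.vertex b) Λ) {j : J} {t : ℝ}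
    (ht : t ∈ Icc 0 (N.len j)) (hx : x = N.param j t) :
    ∃ s, (s = 0 ∨ s = N.len j) ∧
      |∫ r in t..s, 1 / η j r| + N.bdDist η (N.param j s) ≤ Λ := by
  by_cases hti : t ∈ Ioo 0 (N.len j)
  -- An interior point lies on no other edge, so the first piece of the path runs in the edge `j`
  -- and stops at one of its ends. In the remaining case the point is itself an end and `s = t` will
  -- do.
  · generalize hy : N.vertex b = y at h
    cases h with
    | single k s' t' hs' ht' =>
      obtain ⟨rfl, rfl⟩ := eq_of_param_eq hti hs' hx.symm
      refine ⟨t', eq_zero_or_len_of_param_eq_vertex ht' hy.symm, ?_⟩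
      rw [← hy, bdDist_boundary (j := j) ⟨t', ht', hy.symm⟩ hb, add_zero]
    | cons k s' t' hs' ht' i hi _ Λ' h' =>
      obtain ⟨rfl, rfl⟩ := eq_of_param_eq hti hs' hx.symm
      refine ⟨t', eq_zero_or_len_of_param_eq_vertex ht' hi, ?_⟩
      rw [hi]
      subst hy
      exact add_le_add le_rfl (bdDist_le hb h')
  · refine ⟨t, eq_zero_or_len_of_notMem_Ioo ht hti, ?_⟩
    subst hx
    simpa using bdDist_le hb h

theorem abs_integral_one_div_eq (hη : N.IsCapacity η) {j : J} {s t : ℝ}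
    (hs : s ∈ Icc 0 (N.len j)) (ht : t ∈ Icc 0 (N.len j)) :
    |∫ r in s..t, 1 / η j r| = |arcLength (η j) t - arcLength (η j) s| := by
  rw [integral_one_div_eq_arcLength_sub (hη j).1 (hη j).2 hs ht]

theorem arcLength_mono (hη : N.IsCapacity η) (j : J) :
    StrictMonoOn (arcLength (η j)) (Icc 0 (N.len j)) :=
  strictMonoOn_arcLength (hη j).1 (hη j).2

/-- Along an edge the distance is the distance of one point of the edge, the top, minus the weighted
length of the piece between. -/
theorem exists_edge_top (hη : N.IsCapacity η) (j : J) :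
    ∃ p ∈ Icc 0 (N.len j), ∀ t ∈ Icc 0 (N.len j), N.bdDist η (N.param j t) =
      N.bdDist η (N.param j p) - |arcLength (η j) t - arcLength (η j) p| := by
  set g := arcLength (η j) with hg
  set L := N.len j with hL
  set a := N.bdDist η (N.param j 0) with ha
  set b := N.bdDist η (N.param j L) with hb
  have g0 : g 0 = 0 := by simp [hg, arcLength]
  have gm : StrictMonoOn g (Icc 0 L) := arcLength_mono hη j
  have h0 := N.zero_mem j
  have hLm := N.len_mem j
  have e : ∀ {s t : ℝ}, s ∈ Icc 0 L → t ∈ Icc 0 L → |∫ r in s..t, 1 / η j r| = |g t - g s| :=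
    fun hs ht => abs_integral_one_div_eq hη hs ht
  have ub0 : ∀ t ∈ Icc 0 L, N.bdDist η (N.param j t) ≤ a + g t := by
    intro t ht
    have h1 := bdDist_le_add (η := η) ht h0 (param_src j)
    rw [e ht h0, g0, zero_sub, abs_neg, abs_of_nonneg] at h1
    · linarith
    · rw [← g0]; exact gm.monotoneOn h0 ht ht.1
  have ubL : ∀ t ∈ Icc 0 L, N.bdDist η (N.param j t) ≤ b + (g L - g t) := by
    intro t ht
    have h1 := bdDist_le_add (η := η) ht hLm (param_tgt j)
    rw [e ht hLm, abs_of_nonneg] at h1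
    · linarith
    · exact sub_nonneg.2 (gm.monotoneOn ht hLm ht.2)
  have lb : ∀ t ∈ Icc 0 L, min (a + g t) (b + (g L - g t)) ≤ N.bdDist η (N.param j t) := by
    intro t ht
    refine le_bdDist ht fun b' hb' Λ hΛ => ?_
    obtain ⟨s, rfl | rfl, h⟩ := exists_end_le_of_isPathLength hb' hΛ ht rfl
    · rw [e ht h0, g0, zero_sub, abs_neg] at h
      exact (min_le_left _ _).trans (by linarith [le_abs_self (g t)])
    · rw [← hL, e ht hLm] at h
      exact (min_le_right _ _).trans (by linarith [le_abs_self (g L - g t)])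
  have eq : ∀ t ∈ Icc 0 L, N.bdDist η (N.param j t) = min (a + g t) (b + (g L - g t)) :=
    fun t ht => le_antisymm (le_min (ub0 t ht) (ubL t ht)) (lb t ht)
  have h1 := ub0 L hLm
  have h2 := ubL 0 h0
  rw [g0] at h2
  -- The top is where the routes through the two ends are equally long: `a + g p = b + (g L - g p)`.
  -- The bounds `h1` and `h2` say that `|b - a| ≤ g L`, which places the required value in the range
  -- of `g`.
  obtain ⟨p, hp, hgp⟩ := intermediate_value_Icc (N.len_pos j).le
    (continuousOn_arcLength (hη j).1 (hη j).2)
    (show (b - a + g L) / 2 ∈ Icc (g 0) (g L) by rw [g0]; constructor <;> linarith)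
  replace hgp : g p = (b - a + g L) / 2 := hgp
  refine ⟨p, hp, fun t ht => ?_⟩
  rw [eq t ht, eq p hp]
  have h3 : b + (g L - g p) = a + g p := by linarith
  rw [h3, min_self]
  rcases le_total t p with h | h
  · have := gm.monotoneOn ht hp h
    rw [min_eq_left (by linarith), abs_of_nonpos (by linarith)]
    ring
  · have := gm.monotoneOn hp ht h
    rw [min_eq_right (by linarith), abs_of_nonneg (by linarith)]
    linarith

/-- The point of the edge at which the distance from the boundary is largest. -/
noncomputable def top (hη : N.IsCapacity η) (j : J) : ℝ := (exists_edge_top hη j).choose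

theorem top_mem (hη : N.IsCapacity η) (j : J) : top hη j ∈ Icc 0 (N.len j) :=
  (exists_edge_top hη j).choose_spec.1

theorem bdDist_param (hη : N.IsCapacity η) {j : J} {t : ℝ} (ht : t ∈ Icc 0 (N.len j)) :
    N.bdDist η (N.param j t) = N.bdDist η (N.param j (top hη j)) -
      |arcLength (η j) t - arcLength (η j) (top hη j)| :=
  (exists_edge_top hη j).choose_spec.2 t ht

theorem bdDist_param_lt (hη : N.IsCapacity η) {j : J} {t : ℝ} (ht : t ∈ Icc 0 (N.len j))
    (h : t ≠ top hη j) : N.bdDist η (N.param j t) < N.bdDist η (N.param j (top hη j)) := by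
  rw [bdDist_param hη ht]
  have h1 : arcLength (η j) t ≠ arcLength (η j) (top hη j) := fun h' =>
    h ((arcLength_mono hη j).injOn ht (top_mem hη j) h')
  have := abs_pos.2 (sub_ne_zero.2 h1)
  linarith

/-- At a boundary vertex `d = 0`. Were it the top of an edge, `d` would be negative elsewhere on
that edge. -/
theorem notMem_boundary_of_top (hη : N.IsCapacity η) {i : I} {j : J} (hij : N.Incident i j)
    (h : N.paramInv j (N.vertex i) = top hη j) : i ∉ N.boundary := by
  intro hi
  have h1 := bdDist_boundary (η := η) hij hi
  rw [← param_paramInv hij, h] at h1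
  obtain ⟨t, ht, hne⟩ : ∃ t ∈ Icc 0 (N.len j), t ≠ top hη j := by
    by_cases h0 : top hη j = 0
    · exact ⟨_, N.len_mem j, by rw [h0]; exact (N.len_pos j).ne'⟩
    · exact ⟨_, N.zero_mem j, Ne.symm h0⟩
  have := bdDist_param_lt hη ht hne
  linarith [bdDist_nonneg (N := N) (η := η) (N.param j t)]

/-- A path to the boundary has to leave a transition vertex along some edge. -/
theorem exists_opposite_le_of_isPathLength {x : EuclideanSpace ℝ (Fin n)} {b : I}
    (hb : b ∈ N.boundary) {Λ : ℝ} (h : N.IsPathLength η x (N.vertex b) Λ) {i : I}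
    (hi : i ∉ N.boundary) (hx : x = N.vertex i) :
    ∃ j, ∃ s ∈ Icc 0 (N.len j), ∃ t ∈ Icc 0 (N.len j), s ≠ t ∧ N.param j s = N.vertex i ∧
      (∃ i', N.param j t = N.vertex i') ∧
      |∫ r in s..t, 1 / η j r| + N.bdDist η (N.param j t) ≤ Λ := by
  generalize hy : N.vertex b = y at h
  induction h generalizing i with
  | single j s t hs ht =>
    refine ⟨j, s, hs, t, ht, ?_, hx, ⟨b, hy.symm⟩, ?_⟩
    · rintro rfl
      rw [← hy] at hx
      exact hi (N.vertex_injective hx ▸ hb)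
    · rw [← hy, bdDist_boundary (j := j) ⟨t, ht, hy.symm⟩ hb, add_zero]
  | cons j s t hs ht i' hi' y Λ h ih =>
    -- A degenerate first piece remains at the vertex and can be dropped. Otherwise the piece
    -- already crosses an edge to its other end.
    by_cases hst : s = t
    · subst hst
      obtain ⟨j', s', hs', t', ht', h1, h2, h3, h4⟩ := ih hi (hi'.symm.trans hx) hy
      refine ⟨j', s', hs', t', ht', h1, h2, h3, h4.trans ?_⟩
      simp
    · refine ⟨j, s, hs, t, ht, hst, hx, ⟨i', hi'⟩, ?_⟩
      subst hy
      rw [hi']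
      exact add_le_add le_rfl (bdDist_le hb h)

/-- If no incident edge had its top at `i`, crossing any of them to the opposite end and continuing
from there would cost strictly more than `d` at `i`. There are finitely many such routes, so the
excess is bounded below by a positive gap, which contradicts that `d` is an infimum over paths. -/
theorem exists_incident_top [Finite J] (hη : N.IsCapacity η) {i : I} {j₀ : J}
    (hj₀ : N.Incident i j₀) (hi : i ∉ N.boundary) :
    ∃ j, N.Incident i j ∧ N.paramInv j (N.vertex i) = top hη j := by
  by_contra! hcon
  set D := N.bdDist η (N.vertex i) with hD
  let S : Set ℝ := {c | ∃ j, ∃ s, ∃ t, (s = 0 ∨ s = N.len j) ∧ (t = 0 ∨ t = N.len j) ∧ s ≠ t ∧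
    N.param j s = N.vertex i ∧ c = |∫ r in s..t, 1 / η j r| + N.bdDist η (N.param j t)}
  have hfin : S.Finite := by
    let F : J × Bool × Bool → ℝ := fun q =>
      |∫ r in (if q.2.1 then 0 else N.len q.1)..(if q.2.2 then 0 else N.len q.1), 1 / η q.1 r| +
        N.bdDist η (N.param q.1 (if q.2.2 then 0 else N.len q.1))
    refine (finite_range F).subset ?_
    rintro c ⟨j, s, t, rfl | rfl, rfl | rfl, -, -, rfl⟩
    · exact ⟨(j, true, true), by simp [F]⟩
    · exact ⟨(j, true, false), by simp [F]⟩
    · exact ⟨(j, false, true), by simp [F]⟩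
    · exact ⟨(j, false, false), by simp [F]⟩
  have hlt : ∀ c ∈ S, D < c := by
    rintro c ⟨j, s, t, hs, ht, hst, hsi, rfl⟩
    have hs' : s ∈ Icc 0 (N.len j) := by
      rcases hs with rfl | rfl
      exacts [N.zero_mem j, N.len_mem j]
    have ht' : t ∈ Icc 0 (N.len j) := by
      rcases ht with rfl | rfl
      exacts [N.zero_mem j, N.len_mem j]
    have h1 := hcon j ⟨s, hs', hsi⟩
    rw [← hsi, paramInv_param hs'] at h1
    rw [hD, ← hsi, abs_integral_one_div_eq hη hs' ht', bdDist_param hη hs', bdDist_param hη ht']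
    set g := arcLength (η j)
    set p := top hη j
    have hp : p ∈ Icc 0 (N.len j) := top_mem hη j
    have gm : StrictMonoOn g (Icc 0 (N.len j)) := arcLength_mono hη j
    rcases hs with rfl | rfl
    · obtain rfl : t = N.len j := ht.resolve_left (Ne.symm hst)
      have h2 := gm hs' hp (lt_of_le_of_ne hp.1 h1)
      have h3 := gm.monotoneOn hp ht' hp.2
      rw [abs_of_neg (by linarith), abs_of_nonneg (by linarith : 0 ≤ g (N.len j) - g p),
        abs_of_pos (by linarith)]
      linarith
    · obtain rfl : t = 0 := ht.resolve_right (Ne.symm hst)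
      have h2 := gm hp hs' (lt_of_le_of_ne hp.2 h1.symm)
      have h3 := gm.monotoneOn ht' hp hp.1
      rw [abs_of_pos (by linarith : 0 < g (N.len j) - g p), abs_of_neg (by linarith),
        abs_of_nonpos (by linarith)]
      linarith
  -- The gap is the smallest candidate cost; with no candidates any number above `D` serves.
  obtain ⟨δ, hδ, hδ'⟩ : ∃ δ > D, ∀ c ∈ S, δ ≤ c := by
    rcases S.eq_empty_or_nonempty with h | h
    · exact ⟨D + 1, by linarith, by simp [h]⟩
    · obtain ⟨m, hm, hm'⟩ := hfin.exists_minimal h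
      exact ⟨m, hlt m hm, fun c hc => (le_total m c).elim id fun h => hm' hc h⟩
  have h1 : δ ≤ D := by
    rw [hD, ← param_paramInv hj₀]
    refine le_bdDist (paramInv_mem hj₀) fun b hb Λ hΛ => ?_
    obtain ⟨j, s, hs, t, ht, hst, h2, ⟨i', h3⟩, h4⟩ :=
      exists_opposite_le_of_isPathLength hb hΛ hi (param_paramInv hj₀)
    exact (hδ' _ ⟨j, s, t, eq_zero_or_len_of_param_eq_vertex hs h2,
      eq_zero_or_len_of_param_eq_vertex ht h3, hst, h2, rfl⟩).trans h4
  linarith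

/-! ### The slope of the distance along an edge -/

theorem inv_capacity_pos (hη : N.IsCapacity η) {j : J} {t : ℝ} (ht : t ∈ Icc 0 (N.len j)) :
    0 < 1 / η j t :=
  one_div_pos.2 ((hη j).2 t ht)

theorem proj_bdDist_of_le (hη : N.IsCapacity η) {j : J} {s : ℝ} (hs : s ∈ Icc 0 (N.len j))
    (h : s ≤ top hη j) : N.proj (N.bdDist η) j s =
      N.bdDist η (N.param j (top hη j)) - arcLength (η j) (top hη j) + arcLength (η j) s := by
  have := (arcLength_mono hη j).monotoneOn hs (top_mem hη j) h
  rw [proj, bdDist_param hη hs, abs_of_nonpos (by linarith)]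
  ring

theorem proj_bdDist_of_ge (hη : N.IsCapacity η) {j : J} {s : ℝ} (hs : s ∈ Icc 0 (N.len j))
    (h : top hη j ≤ s) : N.proj (N.bdDist η) j s =
      N.bdDist η (N.param j (top hη j)) + arcLength (η j) (top hη j) - arcLength (η j) s := by
  have := (arcLength_mono hη j).monotoneOn (top_mem hη j) hs h
  rw [proj, bdDist_param hη hs, abs_of_nonneg (by linarith)]
  ring

/-- The set `s` is left free so that the same computation gives two-sided derivatives, derivatives
at the ends of the edge, and the left derivative at an interior top. -/
theorem hasDerivWithinAt_uphill (hη : N.IsCapacity η) {j : J} {t : ℝ}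
    (ht : t ∈ Icc 0 (N.len j)) (htp : t ≤ top hη j) {s : Set ℝ} (hs : s ⊆ Icc 0 (N.len j))
    (h : ∀ᶠ r in 𝓝[s] t, r ≤ top hη j) :
    HasDerivWithinAt (N.proj (N.bdDist η) j) (1 / η j t) s t := by
  refine ((((hasDerivWithinAt_arcLength (hη j).1 (hη j).2 ht).mono hs).const_add
    (N.bdDist η (N.param j (top hη j)) - arcLength (η j) (top hη j)))).congr_of_eventuallyEq ?_
    (proj_bdDist_of_le hη ht htp)
  filter_upwards [h, self_mem_nhdsWithin] with r hr hr'
  exact proj_bdDist_of_le hη (hs hr') hr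

theorem hasDerivWithinAt_downhill (hη : N.IsCapacity η) {j : J} {t : ℝ}
    (ht : t ∈ Icc 0 (N.len j)) (htp : top hη j ≤ t) {s : Set ℝ} (hs : s ⊆ Icc 0 (N.len j))
    (h : ∀ᶠ r in 𝓝[s] t, top hη j ≤ r) :
    HasDerivWithinAt (N.proj (N.bdDist η) j) (-(1 / η j t)) s t := by
  refine ((((hasDerivWithinAt_arcLength (hη j).1 (hη j).2 ht).mono hs).const_sub
    (N.bdDist η (N.param j (top hη j)) + arcLength (η j) (top hη j)))).congr_of_eventuallyEq ?_
    (proj_bdDist_of_ge hη ht htp)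
  filter_upwards [h, self_mem_nhdsWithin] with r hr hr'
  exact proj_bdDist_of_ge hη (hs hr') hr

theorem hasDerivWithinAt_bdDist_of_lt (hη : N.IsCapacity η) {j : J} {t : ℝ}
    (ht : t ∈ Icc 0 (N.len j)) (htp : t < top hη j) :
    HasDerivWithinAt (N.proj (N.bdDist η) j) (1 / η j t) (Icc 0 (N.len j)) t :=
  hasDerivWithinAt_uphill hη ht htp.le subset_rfl
    (nhdsWithin_le_nhds ((eventually_lt_nhds htp).mono fun _ h => h.le))

theorem hasDerivWithinAt_bdDist_of_gt (hη : N.IsCapacity η) {j : J} {t : ℝ}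
    (ht : t ∈ Icc 0 (N.len j)) (htp : top hη j < t) :
    HasDerivWithinAt (N.proj (N.bdDist η) j) (-(1 / η j t)) (Icc 0 (N.len j)) t :=
  hasDerivWithinAt_downhill hη ht htp.le subset_rfl
    (nhdsWithin_le_nhds ((eventually_gt_nhds htp).mono fun _ h => h.le))

theorem hasDerivWithinAt_bdDist_len (hη : N.IsCapacity η) {j : J} (h : top hη j = N.len j) :
    HasDerivWithinAt (N.proj (N.bdDist η) j) (1 / η j (N.len j)) (Icc 0 (N.len j)) (N.len j) :=
  hasDerivWithinAt_uphill hη (N.len_mem j) h.ge subset_rfl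
    (eventually_mem_nhdsWithin.mono fun _ hr => hr.2.trans h.ge)

theorem hasDerivWithinAt_bdDist_zero (hη : N.IsCapacity η) {j : J} (h : top hη j = 0) :
    HasDerivWithinAt (N.proj (N.bdDist η) j) (-(1 / η j 0)) (Icc 0 (N.len j)) 0 :=
  hasDerivWithinAt_downhill hη (N.zero_mem j) h.le subset_rfl
    (eventually_mem_nhdsWithin.mono fun _ hr => h.le.trans hr.1)

theorem hasDerivAt_of_mem_Ioo {L t m : ℝ} {g : ℝ → ℝ} (ht : t ∈ Ioo 0 L)
    (h : HasDerivWithinAt g m (Icc 0 L) t) : HasDerivAt g m t :=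
  h.hasDerivAt (Icc_mem_nhds ht.1 ht.2)

/-- A derivative at this interior maximum would be zero, whereas the left derivative is `1 / η > 0`.
-/
theorem not_differentiableAt_top (hη : N.IsCapacity η) {j : J}
    (h : top hη j ∈ Ioo 0 (N.len j)) :
    ¬ DifferentiableAt ℝ (N.proj (N.bdDist η) j) (top hη j) := by
  intro hd
  have hm : IsLocalMax (N.proj (N.bdDist η) j) (top hη j) := by
    filter_upwards [Icc_mem_nhds h.1 h.2] with s hs
    by_cases hsp : s = top hη j
    · rw [hsp]
    · exact (bdDist_param_lt hη hs hsp).le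
  have h0 := hm.hasDerivAt_eq_zero hd.hasDerivAt
  have h1 := hasDerivWithinAt_uphill hη (top_mem hη j) le_rfl
    (Icc_subset_Icc_right h.2.le : Icc 0 (top hη j) ⊆ _)
    (eventually_mem_nhdsWithin.mono fun _ hr => hr.2)
  have h2 := (uniqueDiffOn_Icc h.1 _ (right_mem_Icc.2 h.1.le)).eq_deriv _
    hd.hasDerivAt.hasDerivWithinAt h1
  have := inv_capacity_pos hη (top_mem hη j)
  linarith

theorem differentiableAt_bdDist_iff (hη : N.IsCapacity η) {j : J} {t : ℝ}
    (ht : t ∈ Ioo 0 (N.len j)) :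
    DifferentiableAt ℝ (N.proj (N.bdDist η) j) t ↔ t ≠ top hη j := by
  constructor
  · rintro h rfl
    exact not_differentiableAt_top hη ht h
  · intro h
    rcases lt_or_gt_of_ne h with h | h
    · exact (hasDerivAt_of_mem_Ioo ht (hasDerivWithinAt_bdDist_of_lt hη
        (Ioo_subset_Icc_self ht) h)).differentiableAt
    · exact (hasDerivAt_of_mem_Ioo ht (hasDerivWithinAt_bdDist_of_gt hη
        (Ioo_subset_Icc_self ht) h)).differentiableAt

theorem mem_singEdge_iff (hη : N.IsCapacity η) {j : J} {t : ℝ} :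
    t ∈ N.singEdge (N.bdDist η) j ↔ t ∈ Ioo 0 (N.len j) ∧ t = top hη j := by
  constructor
  · rintro ⟨h1, h2⟩
    rw [differentiableAt_bdDist_iff hη h1, not_not] at h2
    exact ⟨h1, h2⟩
  · rintro ⟨h1, h2⟩
    exact ⟨h1, by rwa [differentiableAt_bdDist_iff hη h1, not_not]⟩

theorem edgeDeriv_eq {u : EuclideanSpace ℝ (Fin n) → ℝ} {j : J} {t m : ℝ}
    (ht : t ∈ Icc 0 (N.len j)) (h : HasDerivWithinAt (N.proj u j) m (Icc 0 (N.len j)) t) :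
    N.edgeDeriv u j t = m :=
  h.derivWithin (uniqueDiffOn_Icc (N.len_pos j) t ht)

theorem capacity_mul_inv (hη : N.IsCapacity η) {j : J} {t : ℝ} (ht : t ∈ Icc 0 (N.len j)) :
    η j t * (1 / η j t) = 1 :=
  mul_one_div_cancel ((hη j).2 t ht).ne'

/-- The direction in which the distance increases. -/
theorem capacity_mul_edgeDeriv_of_lt (hη : N.IsCapacity η) {j : J} {t : ℝ}
    (ht : t ∈ Icc 0 (N.len j)) (htp : t < top hη j) :
    η j t * N.edgeDeriv (N.bdDist η) j t = 1 := by
  rw [edgeDeriv_eq ht (hasDerivWithinAt_bdDist_of_lt hη ht htp), capacity_mul_inv hη ht]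

theorem capacity_mul_edgeDeriv_of_gt (hη : N.IsCapacity η) {j : J} {t : ℝ}
    (ht : t ∈ Icc 0 (N.len j)) (htp : top hη j < t) :
    η j t * N.edgeDeriv (N.bdDist η) j t = -1 := by
  rw [edgeDeriv_eq ht (hasDerivWithinAt_bdDist_of_gt hη ht htp), mul_neg, capacity_mul_inv hη ht]

/-! ### Slopes at the vertices -/

/-- No edge is a loop, so a vertex is only one of its two ends and the two alternatives in the
definition exclude each other. -/
theorem HasOrientedDeriv.unique {u : EuclideanSpace ℝ (Fin n) → ℝ} {i : I} {j : J} {p q : ℝ}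
    (hp : N.HasOrientedDeriv u i j p) (hq : N.HasOrientedDeriv u i j q) : p = q := by
  have hne : N.param j 0 ≠ N.param j (N.len j) := fun h =>
    (N.len_pos j).ne (N.param_injOn j (N.zero_mem j) (N.len_mem j) h)
  have hu := uniqueDiffOn_Icc (N.len_pos j)
  rcases hp with ⟨h1, h2⟩ | ⟨h1, h2⟩ <;> rcases hq with ⟨h3, h4⟩ | ⟨h3, h4⟩
  · exact (hu _ (N.zero_mem j)).eq_deriv _ h2 h4
  · exact absurd (h1.symm.trans h3) hne
  · exact absurd (h3.symm.trans h1) hne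
  · exact neg_injective ((hu _ (N.len_mem j)).eq_deriv _ h2 h4)

theorem hasOrientedDeriv_top (hη : N.IsCapacity η) {i : I} {j : J} (hij : N.Incident i j)
    (h : N.paramInv j (N.vertex i) = top hη j) :
    N.HasOrientedDeriv (N.bdDist η) i j (-(1 / η j (N.paramInv j (N.vertex i)))) := by
  rcases incident_iff.1 hij with rfl | rfl
  · rw [paramInv_src] at h ⊢
    exact Or.inl ⟨(param_src j).symm, hasDerivWithinAt_bdDist_zero hη h.symm⟩
  · rw [paramInv_tgt] at h ⊢
    exact Or.inr ⟨(param_tgt j).symm, by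
      rw [neg_neg]; exact hasDerivWithinAt_bdDist_len hη h.symm⟩

theorem hasOrientedDeriv_of_ne_top (hη : N.IsCapacity η) {i : I} {j : J} (hij : N.Incident i j)
    (h : N.paramInv j (N.vertex i) ≠ top hη j) :
    N.HasOrientedDeriv (N.bdDist η) i j (1 / η j (N.paramInv j (N.vertex i))) := by
  rcases incident_iff.1 hij with rfl | rfl
  · rw [paramInv_src] at h ⊢
    exact Or.inl ⟨(param_src j).symm, hasDerivWithinAt_bdDist_of_lt hη (N.zero_mem j)
      (lt_of_le_of_ne (top_mem hη j).1 h)⟩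
  · rw [paramInv_tgt] at h ⊢
    exact Or.inr ⟨(param_tgt j).symm, hasDerivWithinAt_bdDist_of_gt hη (N.len_mem j)
      (lt_of_le_of_ne (top_mem hη j).2 h.symm)⟩

/-- The slope of `d` is `±1 / η` at every incident edge, so the transmission clause for undefined
slopes is vacuous for `d`. -/
theorem slopeDefined_bdDist (hη : N.IsCapacity η) {i : I} {j : J} (hij : N.Incident i j) :
    N.SlopeDefined (N.bdDist η) i j := by
  have hpos := inv_capacity_pos hη (paramInv_mem hij)
  by_cases h : N.paramInv j (N.vertex i) = top hη j
  · exact ⟨_, by linarith, hasOrientedDeriv_top hη hij h⟩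
  · exact ⟨_, hpos.ne', hasOrientedDeriv_of_ne_top hη hij h⟩

theorem mem_incMinus_iff [Fintype J] (hη : N.IsCapacity η) {i : I} {j : J} :
    j ∈ N.incMinus (N.bdDist η) i ↔
      N.Incident i j ∧ N.paramInv j (N.vertex i) = top hη j := by
  simp only [incMinus, Finset.mem_filter, Finset.mem_univ, true_and]
  refine and_congr_right fun hij => ?_
  have hpos := inv_capacity_pos hη (paramInv_mem hij)
  constructor
  · rintro ⟨p, hp, h⟩
    by_contra hne
    have := h.unique (hasOrientedDeriv_of_ne_top hη hij hne)
    linarith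
  · intro h
    exact ⟨_, by linarith, hasOrientedDeriv_top hη hij h⟩

theorem mem_incPlus_iff [Fintype J] (hη : N.IsCapacity η) {i : I} {j : J} :
    j ∈ N.incPlus (N.bdDist η) i ↔
      N.Incident i j ∧ N.paramInv j (N.vertex i) ≠ top hη j := by
  simp only [incPlus, Finset.mem_filter, Finset.mem_univ, true_and]
  refine and_congr_right fun hij => ?_
  have hpos := inv_capacity_pos hη (paramInv_mem hij)
  constructor
  · rintro ⟨p, hp, h⟩ he
    have := h.unique (hasOrientedDeriv_top hη hij he)
    linarith
  · intro h
    exact ⟨_, hpos, hasOrientedDeriv_of_ne_top hη hij h⟩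

/-! ### The projection -/

theorem mem_topEnd_iff [Fintype J] (hη : N.IsCapacity η) {j : J} {t : ℝ} :
    t ∈ N.topEnd (N.bdDist η) j ↔ t = top hη j ∧ t ∉ Ioo 0 (N.len j) := by
  constructor
  · rintro ⟨i, hi, rfl⟩
    obtain ⟨hij, h⟩ := (mem_incMinus_iff hη).1 hi
    refine ⟨h, fun h' => ?_⟩
    exact N.vertex_not_interior j _ h' i (param_paramInv hij)
  · rintro ⟨rfl, h⟩
    rcases eq_zero_or_len_of_notMem_Ioo (top_mem hη j) h with h | h
    · exact ⟨N.src j, (mem_incMinus_iff hη).2 ⟨incident_src j, by rw [paramInv_src, h]⟩,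
        by rw [paramInv_src, h]⟩
    · exact ⟨N.tgt j, (mem_incMinus_iff hη).2 ⟨incident_tgt j, by rw [paramInv_tgt, h]⟩,
        by rw [paramInv_tgt, h]⟩

/-- An interior top is a kink and an end point top is a downhill end, and no other point is either.
-/
theorem projSet_eq [Fintype J] (hη : N.IsCapacity η) (j : J) :
    N.projSet (N.bdDist η) j = {top hη j} := by
  ext t
  rw [projSet, mem_union, mem_singEdge_iff hη, mem_topEnd_iff hη, mem_singleton_iff]
  tauto

/-- The ray moves towards the top at unit parameter speed, since `η d' = ±1`. At the top itself `s =
0` works whatever value the derivative has there. -/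
theorem isLeast_hitTimes [Fintype J] (hη : N.IsCapacity η) {j : J} {t : ℝ}
    (ht : t ∈ Icc 0 (N.len j)) : IsLeast (N.hitTimes η j t) |top hη j - t| := by
  simp only [hitTimes, projSet_eq hη, mem_singleton_iff]
  rcases lt_trichotomy t (top hη j) with h | h | h
  · rw [capacity_mul_edgeDeriv_of_lt hη ht h, abs_of_pos (by linarith)]
    exact ⟨⟨by linarith, by ring⟩, fun s hs => by linarith [hs.2]⟩
  · rw [← h, sub_self, abs_zero]
    exact ⟨⟨le_rfl, by ring⟩, fun s hs => hs.1⟩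
  · rw [capacity_mul_edgeDeriv_of_gt hη ht h, abs_of_neg (by linarith)]
    exact ⟨⟨by linarith, by ring⟩, fun s hs => by linarith [hs.2]⟩

theorem tau_eq [Fintype J] (hη : N.IsCapacity η) {j : J} {t : ℝ}
    (ht : t ∈ Icc 0 (N.len j)) : N.tau η j t = |top hη j - t| :=
  (isLeast_hitTimes hη ht).csInf_eq

theorem projPt_eq [Fintype J] (hη : N.IsCapacity η) {j : J} {t : ℝ}
    (ht : t ∈ Icc 0 (N.len j)) : N.projPt η j t = top hη j := by
  have h := (isLeast_hitTimes hη ht).1.2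
  rw [projSet_eq hη, mem_singleton_iff, ← tau_eq hη ht] at h
  exact h

/-- The mass of the source between a point of an edge and the top. -/
noncomputable def edgeMass (hη : N.IsCapacity η) (f : J → ℝ → ℝ) (j : J) (t : ℝ) : ℝ :=
  ∫ r in min t (top hη j)..max t (top hη j), f j r

theorem integral_tau_eq [Fintype J] (hη : N.IsCapacity η) (f : J → ℝ → ℝ) {j : J} {t : ℝ}
    (ht : t ∈ Icc 0 (N.len j)) :
    ∫ r in 0..N.tau η j t, f j (t + r * (η j t * N.edgeDeriv (N.bdDist η) j t)) =
      edgeMass hη f j t := by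
  rw [tau_eq hη ht, edgeMass]
  rcases lt_trichotomy t (top hη j) with h | h | h
  · rw [capacity_mul_edgeDeriv_of_lt hη ht h, abs_of_pos (by linarith), min_eq_left h.le,
      max_eq_right h.le]
    simp only [mul_one]
    rw [intervalIntegral.integral_comp_add_left]
    simp
  · rw [← h]; simp
  · rw [capacity_mul_edgeDeriv_of_gt hη ht h, abs_of_neg (by linarith), min_eq_right h.le,
      max_eq_left h.le]
    simp only [mul_neg, mul_one, ← sub_eq_add_neg]
    rw [intervalIntegral.integral_comp_sub_left]
    simp

open Classical in
/-- The mass which enters an edge at its top end, if it has one, when the masses `F i` come into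
the vertices. -/
noncomputable def topMass [Fintype I] [Fintype J] (N : Network n I J) (η : J → ℝ → ℝ)
    (C : I → Finset J → J → ℝ) (F : I → ℝ) (j : J) : ℝ :=
  ∑ i with j ∈ N.incMinus (N.bdDist η) i, C i (N.incMinus (N.bdDist η) i) j * F i

/-- The mass coming into a vertex. -/
noncomputable def inflow [Fintype J] (N : Network n I J) (η : J → ℝ → ℝ) (v : J → ℝ → ℝ)
    (i : I) : ℝ :=
  ∑ k ∈ N.incPlus (N.bdDist η) i, v k (N.paramInv k (N.vertex i))

/-- The projection is the top for every `t`, so the vertex term is constant along the edge. The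
formula thereby reduces to finitely many unknowns, the inflows. -/
theorem represents_iff [Fintype I] [Fintype J] (hη : N.IsCapacity η) {f : J → ℝ → ℝ}
    {C : I → Finset J → J → ℝ} {v : J → ℝ → ℝ} :
    N.Represents η f C v ↔ ∀ j, ∀ t ∈ Icc 0 (N.len j),
      v j t = edgeMass hη f j t + N.topMass η C (N.inflow η v) j := by
  classical
  refine forall_congr' fun j => forall₂_congr fun t ht => ?_
  rw [integral_tau_eq hη f ht, projPt_eq hη ht]
  suffices h : (N.topEnd (N.bdDist η) j).indicator
        (fun p => ∑ i with N.vertex i = N.param j p,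
          C i (N.incMinus (N.bdDist η) i) j *
            ∑ k ∈ N.incPlus (N.bdDist η) i, v k (N.paramInv k (N.vertex i))) (top hη j) =
      N.topMass η C (N.inflow η v) j by rw [← h]
  have hiff : ∀ i, j ∈ N.incMinus (N.bdDist η) i ↔ N.vertex i = N.param j (top hη j) := by
    intro i
    rw [mem_incMinus_iff hη]
    constructor
    · rintro ⟨h1, h2⟩
      rw [← h2, param_paramInv h1]
    · intro h
      exact ⟨⟨_, top_mem hη j, h.symm⟩, by rw [h, paramInv_param (top_mem hη j)]⟩
  by_cases h : top hη j ∈ N.topEnd (N.bdDist η) j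
  · rw [indicator_of_mem h, topMass]
    refine Finset.sum_congr ?_ fun i _ => rfl
    ext i
    simp [hiff]
  · rw [indicator_of_notMem h, topMass, Finset.sum_eq_zero]
    intro i hi
    refine absurd ?_ h
    rw [Finset.mem_filter] at hi
    exact ⟨i, hi.2, (((mem_incMinus_iff hη).1 hi.2).2).symm⟩

end Network

/-! ### Triangular linear systems and the orientation of an edge -/

/-- A linear system which is strictly triangular with respect to a height function has exactly one
solution. -/
theorem exists_solution_of_triangular {I : Type*} [Fintype I] (d : I → ℝ) (a : I → I → ℝ)
    (ha : ∀ i i', a i i' ≠ 0 → d i < d i') (b : I → ℝ) :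
    ∃ F : I → ℝ, (∀ i, F i = b i + ∑ i', a i i' * F i') ∧
      (∀ G : I → ℝ, (∀ i, G i = b i + ∑ i', a i i' * G i') → G = F) ∧
      ((∀ i, 0 ≤ b i) → (∀ i i', 0 ≤ a i i') → ∀ i, 0 ≤ F i) := by
  classical
  -- The relation puts higher indices first, so recursion along it determines `F i` from the values
  -- at strictly higher indices. It is well founded because `I` is finite.
  let r : I → I → Prop := fun i' i => d i < d i'
  have : IsTrans I r := ⟨fun _ _ _ h1 h2 => lt_trans h2 h1⟩
  have : Std.Irrefl r := ⟨fun _ h => lt_irrefl _ h⟩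
  have wf : WellFounded r := Finite.wellFounded_of_trans_of_irrefl r
  let F : I → ℝ := wf.fix fun i ih =>
    b i + ∑ i', if h : r i' i then a i i' * ih i' h else 0
  have hF : ∀ i, F i = b i + ∑ i', a i i' * F i' := by
    intro i
    have h1 : F i = b i + ∑ i', if r i' i then a i i' * F i' else 0 := by
      simp only [F]
      rw [wf.fix_eq]
      simp only [dite_eq_ite]
    rw [h1]
    congr 1
    refine Finset.sum_congr rfl fun i' _ => ?_
    split_ifs with h
    · rfl
    · rw [show a i i' = 0 from by_contra fun h' => h (ha i i' h'), zero_mul]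
  refine ⟨F, hF, fun G hG => funext fun i => ?_, fun hb ha' i => ?_⟩
  · induction i using wf.induction with
    | _ i ih =>
      rw [hF, hG]
      congr 1
      refine Finset.sum_congr rfl fun i' _ => ?_
      by_cases h : a i i' = 0
      · rw [h, zero_mul, zero_mul]
      · rw [ih i' (ha i i' h)]
  · induction i using wf.induction with
    | _ i ih =>
      rw [hF]
      refine add_nonneg (hb i) (Finset.sum_nonneg fun i' _ => ?_)
      by_cases h : a i i' = 0
      · rw [h, zero_mul]
      · exact mul_nonneg (ha' i i') (ih i' (ha i i' h))

/-- The sign which is `1` before `p` and `-1` from `p` on. -/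
noncomputable def orient (p r : ℝ) : ℝ := if r < p then 1 else -1

theorem memLp_orient_mul {L p : ℝ} {g : ℝ → ℝ} (hg : MemLp g ⊤ (edgeMeasure L)) :
    MemLp (fun r => orient p r * g r) ⊤ (edgeMeasure L) := by
  -- The sign is `2 · 1_{r < p} - 1`.
  have h := ((hg.indicator (measurableSet_Iio (a := p))).const_mul 2).sub hg
  refine (memLp_congr_ae (Eventually.of_forall fun r => ?_)).1 h
  by_cases hr : r < p
  · simp [orient, hr, indicator]; ring
  · simp [orient, hr, indicator]

/-- The sign absorbs the distinction between the two sides of `p`, so the mass between `t` and `p`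
becomes a constant minus a single primitive on the whole interval. -/
theorem integral_orient_mul {L p t : ℝ} {g : ℝ → ℝ} (hg : MemLp g ⊤ (edgeMeasure L))
    (hp : p ∈ Icc 0 L) (ht : t ∈ Icc 0 L) :
    ∫ r in 0..t, orient p r * g r =
      (∫ r in 0..p, g r) - ∫ r in min t p..max t p, g r := by
  have h0 : (0 : ℝ) ∈ Icc 0 L := ⟨le_rfl, hp.1.trans hp.2⟩
  have ig : ∀ {a b : ℝ}, a ∈ Icc 0 L → b ∈ Icc 0 L → IntervalIntegrable g volume a b :=
    fun ha hb => intervalIntegrable_of_memLp_edgeMeasure hg ha hb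
  have io : ∀ {a b : ℝ}, a ∈ Icc 0 L → b ∈ Icc 0 L →
      IntervalIntegrable (fun r => orient p r * g r) volume a b :=
    fun ha hb => intervalIntegrable_of_memLp_edgeMeasure (memLp_orient_mul hg) ha hb
  have e1 : ∀ s, s ≤ p → 0 ≤ s → ∫ r in 0..s, orient p r * g r = ∫ r in 0..s, g r := by
    intro s hs hs0
    apply intervalIntegral.integral_congr_ae
    filter_upwards [Measure.ae_ne volume p] with r hr hr'
    rw [uIoc_of_le hs0] at hr'
    rw [orient, if_pos (lt_of_le_of_ne (hr'.2.trans hs) hr), one_mul]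
  rcases le_total t p with h | h
  · rw [e1 t h ht.1, min_eq_left h, max_eq_right h,
      ← intervalIntegral.integral_add_adjacent_intervals (ig h0 ht) (ig ht hp)]
    ring
  · rw [min_eq_right h, max_eq_left h,
      ← intervalIntegral.integral_add_adjacent_intervals (io h0 hp) (io hp ht), e1 p le_rfl hp.1,
      sub_eq_add_neg, ← intervalIntegral.integral_neg]
    congr 1
    apply intervalIntegral.integral_congr
    intro r hr
    rw [uIcc_of_le h] at hr
    simp only [orient, if_neg (not_lt.2 hr.1), neg_one_mul]

namespace Network

variable {n : ℕ} {I J : Type*} {N : Network n I J} {η f : J → ℝ → ℝ}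

/-! ### The mass of the source along an edge -/

theorem edgeMass_top (hη : N.IsCapacity η) (j : J) : edgeMass hη f j (top hη j) = 0 := by
  simp [edgeMass]

theorem edgeMass_eq_primitive (hη : N.IsCapacity η) (hf : N.IsSource f) {j : J} {t : ℝ}
    (ht : t ∈ Icc 0 (N.len j)) :
    edgeMass hη f j t = edgeMass hη f j 0 + ∫ r in 0..t, -(orient (top hη j) r * f j r) := by
  have hp := top_mem hη j
  rw [intervalIntegral.integral_neg, integral_orient_mul (hf.1 j) hp ht, edgeMass, edgeMass,
    min_eq_left hp.1, max_eq_right hp.1]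
  ring

theorem edgeMass_nonneg (hη : N.IsCapacity η) (hf : N.IsSource f) {j : J} {t : ℝ}
    (ht : t ∈ Icc 0 (N.len j)) : 0 ≤ edgeMass hη f j t := by
  have hp := top_mem hη j
  refine intervalIntegral.integral_nonneg_of_ae_restrict min_le_max ?_
  have h1 : ∀ᵐ r ∂(volume.restrict (Icc 0 (N.len j))), 0 ≤ f j r := by
    rw [← restrict_Ioo_eq_restrict_Icc]
    exact hf.2.1 j
  exact ae_mono (Measure.restrict_mono
    (Icc_subset_Icc (le_min ht.1 hp.1) (max_le ht.2 hp.2)) le_rfl) h1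

theorem memLp_orient_source (hη : N.IsCapacity η) (hf : N.IsSource f) (j : J) :
    MemLp (fun r => -(orient (top hη j) r * f j r)) ⊤ (edgeMeasure (N.len j)) :=
  (memLp_orient_mul (hf.1 j)).neg

/-! ### The flux along an edge -/

theorem flux_eq (v : J → ℝ → ℝ) (j : J) (t : ℝ) :
    N.flux η v j t = v j t * (η j t * N.edgeDeriv (N.bdDist η) j t) := mul_assoc _ _ _

theorem flux_of_lt (hη : N.IsCapacity η) (v : J → ℝ → ℝ) {j : J} {t : ℝ}
    (ht : t ∈ Icc 0 (N.len j)) (h : t < top hη j) : N.flux η v j t = v j t := by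
  rw [flux_eq, capacity_mul_edgeDeriv_of_lt hη ht h, mul_one]

theorem flux_of_gt (hη : N.IsCapacity η) (v : J → ℝ → ℝ) {j : J} {t : ℝ}
    (ht : t ∈ Icc 0 (N.len j)) (h : top hη j < t) : N.flux η v j t = -v j t := by
  rw [flux_eq, capacity_mul_edgeDeriv_of_gt hη ht h, mul_neg_one]

theorem flux_len (hη : N.IsCapacity η) (v : J → ℝ → ℝ) {j : J} (h : top hη j = N.len j) :
    N.flux η v j (N.len j) = v j (N.len j) := by
  rw [flux_eq, edgeDeriv_eq (N.len_mem j) (hasDerivWithinAt_bdDist_len hη h),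
    capacity_mul_inv hη (N.len_mem j), mul_one]

theorem flux_zero (hη : N.IsCapacity η) (v : J → ℝ → ℝ) {j : J} (h : top hη j = 0) :
    N.flux η v j 0 = -v j 0 := by
  rw [flux_eq, edgeDeriv_eq (N.zero_mem j) (hasDerivWithinAt_bdDist_zero hη h), mul_neg,
    capacity_mul_inv hη (N.zero_mem j), mul_neg_one]

/-! ### The solution of the representation formula -/

variable [Fintype J] {C : I → Finset J → J → ℝ}

theorem top_param_eq (hη : N.IsCapacity η) {i : I} {j : J}
    (h : j ∈ N.incMinus (N.bdDist η) i) : N.param j (top hη j) = N.vertex i := by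
  obtain ⟨h1, h2⟩ := (mem_incMinus_iff hη).1 h
  rw [← h2, param_paramInv h1]

theorem distribution_pos (hη : N.IsCapacity η) (hC : N.IsDistribution C) {i : I} {j : J}
    (h : j ∈ N.incMinus (N.bdDist η) i) : 0 < C i (N.incMinus (N.bdDist η) i) j := by
  obtain ⟨h1, h2⟩ := (mem_incMinus_iff hη).1 h
  exact (hC i (notMem_boundary_of_top hη h1 h2) _ ⟨j, h⟩
    fun k hk => ((mem_incMinus_iff hη).1 hk).1).1 j h

theorem inflow_congr (hη : N.IsCapacity η) {v w : J → ℝ → ℝ}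
    (h : ∀ j, ∀ t ∈ Icc 0 (N.len j), v j t = w j t) : N.inflow η v = N.inflow η w :=
  funext fun _ => Finset.sum_congr rfl fun k hk =>
    h k _ (paramInv_mem ((mem_incPlus_iff hη).1 hk).1)

variable [Fintype I]

theorem topMass_eq (hη : N.IsCapacity η) (F : I → ℝ) {i : I} {j : J}
    (h : j ∈ N.incMinus (N.bdDist η) i) :
    N.topMass η C F j = C i (N.incMinus (N.bdDist η) i) j * F i := by
  classical
  rw [topMass, Finset.sum_eq_single_of_mem i (by simpa using h)]
  intro i' hi' hne
  rw [Finset.mem_filter] at hi'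
  exact absurd (N.vertex_injective ((top_param_eq hη hi'.2).symm.trans (top_param_eq hη h))) hne

theorem topMass_eq_zero (hη : N.IsCapacity η) (F : I → ℝ) {j : J}
    (h : top hη j ∈ Ioo 0 (N.len j)) : N.topMass η C F j = 0 := by
  classical
  rw [topMass, Finset.sum_eq_zero]
  intro i hi
  rw [Finset.mem_filter] at hi
  exact absurd (top_param_eq hη hi.2) (N.vertex_not_interior j _ h i)

theorem topMass_nonneg (hη : N.IsCapacity η) (hC : N.IsDistribution C) {F : I → ℝ}
    (hF : ∀ i, 0 ≤ F i) (j : J) : 0 ≤ N.topMass η C F j := by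
  classical
  refine Finset.sum_nonneg fun i hi => ?_
  rw [Finset.mem_filter] at hi
  exact mul_nonneg (distribution_pos hη hC hi.2).le (hF i)

/-- The masses coming into the vertices are determined by the representation formula. -/
theorem exists_inflow (hη : N.IsCapacity η) (hf : N.IsSource f) (hC : N.IsDistribution C) :
    ∃ F : I → ℝ,
      (∀ i, F i = ∑ k ∈ N.incPlus (N.bdDist η) i,
        (edgeMass hη f k (N.paramInv k (N.vertex i)) + N.topMass η C F k)) ∧
      (∀ G : I → ℝ, (∀ i, G i = ∑ k ∈ N.incPlus (N.bdDist η) i,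
        (edgeMass hη f k (N.paramInv k (N.vertex i)) + N.topMass η C G k)) → G = F) ∧
      ∀ i, 0 ≤ F i := by
  classical
  let c : I → J → ℝ := fun i k =>
    if k ∈ N.incMinus (N.bdDist η) i then C i (N.incMinus (N.bdDist η) i) k else 0
  -- The share of the mass entering `i'` that is sent to `i`, along edges with top at `i'` and lower
  -- end at `i`.
  let a : I → I → ℝ := fun i i' => ∑ k ∈ N.incPlus (N.bdDist η) i, c i' k
  let b : I → ℝ := fun i => ∑ k ∈ N.incPlus (N.bdDist η) i,
    edgeMass hη f k (N.paramInv k (N.vertex i))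
  have hc : ∀ i k, 0 ≤ c i k := by
    intro i k
    simp only [c]
    split_ifs with h
    · exact (distribution_pos hη hC h).le
    · exact le_rfl
  have hrw : ∀ (G : I → ℝ) (i : I), ∑ k ∈ N.incPlus (N.bdDist η) i,
      (edgeMass hη f k (N.paramInv k (N.vertex i)) + N.topMass η C G k) =
      b i + ∑ i', a i i' * G i' := by
    intro G i
    rw [Finset.sum_add_distrib]
    congr 1
    have h1 : ∀ k, N.topMass η C G k = ∑ i', c i' k * G i' := by
      intro k
      rw [topMass, Finset.sum_filter]
      refine Finset.sum_congr rfl fun i' _ => ?_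
      simp only [c, ite_mul, zero_mul]
    simp only [h1, a, Finset.sum_mul]
    rw [Finset.sum_comm]
  simp only [hrw]
  obtain ⟨F, h1, h2, h3⟩ := exists_solution_of_triangular (fun i => N.bdDist η (N.vertex i)) a
    (by
      intro i i' h
      -- A nonzero coefficient comes from an edge with its top at `i'` and another end at `i`, and
      -- `d` is strictly larger at the top.
      obtain ⟨k, hk, hk'⟩ := Finset.exists_ne_zero_of_sum_ne_zero h
      have hk2 : k ∈ N.incMinus (N.bdDist η) i' := by
        by_contra h'
        simp [c, h'] at hk'
      obtain ⟨h1, h2⟩ := (mem_incPlus_iff hη).1 hk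
      have := bdDist_param_lt hη (paramInv_mem h1) h2
      rwa [param_paramInv h1, top_param_eq hη hk2] at this) b
  refine ⟨F, h1, h2, h3 (fun i => Finset.sum_nonneg fun k hk => ?_)
    fun i i' => Finset.sum_nonneg fun k _ => hc i' k⟩
  exact edgeMass_nonneg hη hf (paramInv_mem ((mem_incPlus_iff hη).1 hk).1)

/-- The inflows of any solution satisfy the linear system, hence are the ones found above, and they
determine the solution on every edge. -/
theorem exists_represents (hη : N.IsCapacity η) (hf : N.IsSource f) (hC : N.IsDistribution C) :
    ∃ v : J → ℝ → ℝ, N.Represents η f C v ∧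
      (∀ w : J → ℝ → ℝ, N.Represents η f C w → ∀ j, EqOn (w j) (v j) (Icc 0 (N.len j))) ∧
      ∀ j, ∀ t ∈ Icc 0 (N.len j), 0 ≤ v j t := by
  obtain ⟨F, h1, h2, h3⟩ := exists_inflow (N := N) hη hf hC
  let v : J → ℝ → ℝ := fun j t => edgeMass hη f j t + N.topMass η C F j
  have hF : N.inflow η v = F := funext fun i => (h1 i).symm
  refine ⟨v, ?_, fun w hw j t ht => ?_, fun j t ht => ?_⟩
  · rw [represents_iff hη]
    intro j t _
    rw [hF]
  · rw [represents_iff hη] at hw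
    have hG : N.inflow η w = F := h2 _ fun i => congrFun (inflow_congr hη hw) i
    rw [hw j t ht, hG]
  · exact add_nonneg (edgeMass_nonneg hη hf ht) (topMass_nonneg hη hC h3 j)

/-! ### Regularity of the solution and conservation law -/

section Represents

variable {v : J → ℝ → ℝ}

theorem Represents.eq_primitive (hη : N.IsCapacity η) (hf : N.IsSource f)
    (hv : N.Represents η f C v) {j : J} {t : ℝ} (ht : t ∈ Icc 0 (N.len j)) :
    v j t = v j 0 + ∫ r in 0..t, -(orient (top hη j) r * f j r) := by
  rw [represents_iff hη] at hv
  rw [hv j t ht, hv j 0 (N.zero_mem j), edgeMass_eq_primitive hη hf ht]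
  ring

theorem Represents.isW1InftyWith (hη : N.IsCapacity η) (hf : N.IsSource f)
    (hv : N.Represents η f C v) (j : J) :
    IsW1InftyWith (N.len j) (v j) fun r => -(orient (top hη j) r * f j r) :=
  isW1InftyWith_of_primitive (N.len_pos j).le (memLp_orient_source hη hf j)
    fun _ ht => hv.eq_primitive hη hf ht

theorem Represents.continuousOn (hη : N.IsCapacity η) (hf : N.IsSource f)
    (hv : N.Represents η f C v) (j : J) : ContinuousOn (v j) (Icc 0 (N.len j)) :=
  continuousOn_of_primitive (N.len_pos j).le
    (intervalIntegrable_of_memLp_edgeMeasure (memLp_orient_source hη hf j)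
      (N.zero_mem j) (N.len_mem j)) fun _ ht => hv.eq_primitive hη hf ht

theorem Represents.eq_of_mem_incMinus (hη : N.IsCapacity η) (hv : N.Represents η f C v) {i : I}
    {j : J} (h : j ∈ N.incMinus (N.bdDist η) i) :
    v j (N.paramInv j (N.vertex i)) =
      C i (N.incMinus (N.bdDist η) i) j * N.inflow η v i := by
  rw [represents_iff hη] at hv
  rw [((mem_incMinus_iff hη).1 h).2, hv j _ (top_mem hη j), edgeMass_top, zero_add,
    topMass_eq hη _ h]

theorem Represents.top_eq_zero (hη : N.IsCapacity η) (hv : N.Represents η f C v)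
    {j : J} (h : top hη j ∈ Ioo 0 (N.len j)) : v j (top hη j) = 0 := by
  rw [represents_iff hη] at hv
  rw [hv j _ (top_mem hη j), edgeMass_top, zero_add, topMass_eq_zero hη _ h]

/-- Because `v` vanishes at the kink, the default value of the missing derivative plays no role and
the flux does not jump. -/
theorem Represents.flux_top (hη : N.IsCapacity η) (hv : N.Represents η f C v) {j : J}
    (h : top hη j ∈ Ioo 0 (N.len j)) : N.flux η v j (top hη j) = 0 := by
  rw [flux_eq, hv.top_eq_zero hη h, zero_mul]

/-- The flux along an edge is a primitive of `-f`. -/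
theorem Represents.flux_sub (hη : N.IsCapacity η) (hv : N.Represents η f C v) {j : J} {t : ℝ} (ht : t ∈ Icc 0 (N.len j)) :
    N.flux η v j t = N.flux η v j (top hη j) + ∫ r in t..top hη j, f j r := by
  have hp := top_mem hη j
  have hr := (represents_iff hη).1 hv
  have e1 : ∀ s ∈ Icc 0 (N.len j), v j s = v j (top hη j) + edgeMass hη f j s := by
    intro s hs
    rw [hr j s hs, hr j _ hp, edgeMass_top]
    ring
  have e2 : top hη j ∉ Ioo 0 (N.len j) → top hη j = 0 ∨ top hη j = N.len j :=
    eq_zero_or_len_of_notMem_Ioo hp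
  rcases lt_trichotomy t (top hη j) with h | h | h
  · have h1 : N.flux η v j (top hη j) = v j (top hη j) := by
      by_cases hi : top hη j ∈ Ioo 0 (N.len j)
      · rw [hv.flux_top hη hi, hv.top_eq_zero hη hi]
      · have h3 : top hη j = N.len j :=
          (e2 hi).resolve_left (by have := ht.1; intro h0; linarith)
        have h4 := flux_len hη v h3
        rwa [← h3] at h4
    rw [flux_of_lt hη v ht h, h1, e1 t ht, edgeMass, min_eq_left h.le, max_eq_right h.le]
  · rw [← h]; simp
  · have h1 : N.flux η v j (top hη j) = -v j (top hη j) := by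
      by_cases hi : top hη j ∈ Ioo 0 (N.len j)
      · rw [hv.flux_top hη hi, hv.top_eq_zero hη hi, neg_zero]
      · have h3 : top hη j = 0 :=
          (e2 hi).resolve_right (by have := ht.2; intro h0; linarith)
        have h4 := flux_zero hη v h3
        rwa [← h3] at h4
    rw [flux_of_gt hη v ht h, h1, e1 t ht, edgeMass, min_eq_right h.le, max_eq_left h.le,
      intervalIntegral.integral_symm t]
    ring

theorem Represents.flux_eq_primitive (hη : N.IsCapacity η) (hf : N.IsSource f)
    (hv : N.Represents η f C v) {j : J} {t : ℝ} (ht : t ∈ Icc 0 (N.len j)) :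
    N.flux η v j t = N.flux η v j 0 + ∫ r in 0..t, -f j r := by
  have ig : ∀ {a b : ℝ}, a ∈ Icc 0 (N.len j) → b ∈ Icc 0 (N.len j) →
      IntervalIntegrable (f j) volume a b :=
    fun ha hb => intervalIntegrable_of_memLp_edgeMeasure (hf.1 j) ha hb
  rw [hv.flux_sub hη ht, hv.flux_sub hη (N.zero_mem j), intervalIntegral.integral_neg,
    ← intervalIntegral.integral_add_adjacent_intervals (ig (N.zero_mem j) ht)
      (ig ht (top_mem hη j))]
  ring

theorem Represents.hasDerivAt_flux (hη : N.IsCapacity η) (hf : N.IsSource f)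
    (hv : N.Represents η f C v) {j : J} {t : ℝ} (ht : t ∈ Ioo 0 (N.len j))
    (h : HasDerivAt (fun x => ∫ r in 0..x, f j r) (f j t) t) :
    HasDerivAt (N.flux η v j) (-f j t) t := by
  refine (h.const_sub (N.flux η v j 0)).congr_of_eventuallyEq ?_
  filter_upwards [Icc_mem_nhds ht.1 ht.2] with s hs
  rw [hv.flux_eq_primitive hη hf hs, intervalIntegral.integral_neg, sub_eq_add_neg]

theorem Represents.ae_hasDerivAt_flux (hη : N.IsCapacity η) (hf : N.IsSource f)
    (hv : N.Represents η f C v) (j : J) :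
    ∀ᵐ t, t ∈ Ioo 0 (N.len j) → HasDerivAt (N.flux η v j) (-f j t) t := by
  have hi := intervalIntegrable_of_memLp_edgeMeasure (hf.1 j) (N.zero_mem j) (N.len_mem j)
  filter_upwards [hi.ae_hasDerivAt_integral] with t ht ht'
  refine hv.hasDerivAt_flux hη hf ht' (ht ?_ 0 left_mem_uIcc)
  rw [uIcc_of_le (N.len_pos j).le]
  exact Ioo_subset_Icc_self ht'

theorem Represents.hasDerivAt_flux_of_continuousAt (hη : N.IsCapacity η) (hf : N.IsSource f)
    (hv : N.Represents η f C v) {j : J} {t : ℝ} (ht : t ∈ Ioo 0 (N.len j))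
    (h : ContinuousAt (f j) t) : HasDerivAt (N.flux η v j) (-f j t) t :=
  hv.hasDerivAt_flux hη hf ht (intervalIntegral.integral_hasDerivAt_right
    (intervalIntegrable_of_memLp_edgeMeasure (hf.1 j) (N.zero_mem j) (Ioo_subset_Icc_self ht))
    ⟨Ioo 0 (N.len j), Ioo_mem_nhds ht.1 ht.2, (hf.1 j).aestronglyMeasurable⟩ h)

end Represents

end Network

namespace Network

variable {n : ℕ} {I J : Type*} {N : Network n I J} {η f : J → ℝ → ℝ}

/-! ### Regularity of the distance -/

theorem memLp_orient_inv_capacity (hη : N.IsCapacity η) (j : J) :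
    MemLp (fun r => orient (top hη j) r * (1 / η j r)) ⊤ (edgeMeasure (N.len j)) := by
  refine memLp_orient_mul ?_
  have hc := continuousOn_one_div (hη j).1 (hη j).2
  obtain ⟨K, hK⟩ := isCompact_Icc.exists_bound_of_continuousOn hc
  exact memLp_top_of_bound
    ((hc.mono Ioo_subset_Icc_self).aestronglyMeasurable measurableSet_Ioo) K
    ((ae_restrict_iff' measurableSet_Ioo).2
      (Eventually.of_forall fun x hx => hK x (Ioo_subset_Icc_self hx)))

theorem edgeDeriv_eq_orient (hη : N.IsCapacity η) {j : J} {t : ℝ} (ht : t ∈ Icc 0 (N.len j))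
    (h : t ≠ top hη j) :
    N.edgeDeriv (N.bdDist η) j t = orient (top hη j) t * (1 / η j t) := by
  rcases lt_or_gt_of_ne h with h | h
  · rw [edgeDeriv_eq ht (hasDerivWithinAt_bdDist_of_lt hη ht h), orient, if_pos h, one_mul]
  · rw [edgeDeriv_eq ht (hasDerivWithinAt_bdDist_of_gt hη ht h), orient, if_neg h.not_gt,
      neg_one_mul]

theorem proj_bdDist_eq_primitive (hη : N.IsCapacity η) {j : J} {t : ℝ}
    (ht : t ∈ Icc 0 (N.len j)) : N.proj (N.bdDist η) j t =
      N.proj (N.bdDist η) j 0 + ∫ r in 0..t, N.edgeDeriv (N.bdDist η) j r := by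
  have hp := top_mem hη j
  have h0 := N.zero_mem j
  have e1 : ∫ r in 0..t, N.edgeDeriv (N.bdDist η) j r =
      ∫ r in 0..t, orient (top hη j) r * (1 / η j r) := by
    apply intervalIntegral.integral_congr_ae
    filter_upwards [Measure.ae_ne volume (top hη j)] with r hr hr'
    rw [uIoc_of_le ht.1] at hr'
    exact edgeDeriv_eq_orient hη ⟨hr'.1.le, hr'.2.trans ht.2⟩ hr
  -- The sign squares to one, so multiplying by it twice recovers `1 / η`.
  have hm : MemLp (fun r => 1 / η j r) ⊤ (edgeMeasure (N.len j)) := by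
    refine (memLp_congr_ae (Eventually.of_forall fun r => ?_)).1
      (memLp_orient_mul (p := top hη j) (memLp_orient_inv_capacity hη j))
    simp only [orient]
    split_ifs <;> ring
  rw [e1, integral_orient_mul hm hp ht, integral_one_div_eq_arcLength_sub (hη j).1 (hη j).2 h0 hp,
    proj_bdDist_of_le hη h0 hp.1]
  rcases le_total t (top hη j) with h | h
  · rw [min_eq_left h, max_eq_right h,
      integral_one_div_eq_arcLength_sub (hη j).1 (hη j).2 ht hp, proj_bdDist_of_le hη ht h]
    ring
  · rw [min_eq_right h, max_eq_left h,
      integral_one_div_eq_arcLength_sub (hη j).1 (hη j).2 hp ht, proj_bdDist_of_ge hη ht h]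
    ring

theorem isW1InftyWith_proj_bdDist (hη : N.IsCapacity η) (j : J) :
    IsW1InftyWith (N.len j) (N.proj (N.bdDist η) j) (N.edgeDeriv (N.bdDist η) j) := by
  refine isW1InftyWith_of_primitive (N.len_pos j).le ?_
    fun _ ht => proj_bdDist_eq_primitive hη ht
  refine (memLp_congr_ae ?_).1 (memLp_orient_inv_capacity hη j)
  refine (ae_restrict_iff' measurableSet_Ioo).2 ?_
  filter_upwards [Measure.ae_ne volume (top hη j)] with r hr hr'
  exact (edgeDeriv_eq_orient hη (Ioo_subset_Icc_self hr') hr).symm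

theorem isCont_bdDist (hη : N.IsCapacity η) : N.IsCont (N.bdDist η) := fun j =>
  continuousOn_of_primitive (N.len_pos j).le
    (intervalIntegrable_of_memLp_edgeMeasure (isW1InftyWith_proj_bdDist hη j).2.1
      (N.zero_mem j) (N.len_mem j)) fun _ ht => proj_bdDist_eq_primitive hη ht

theorem capacity_mul_abs_edgeDeriv_le (hη : N.IsCapacity η) {j : J} {t : ℝ}
    (ht : t ∈ Icc 0 (N.len j)) (h : t ≠ top hη j) :
    η j t * |N.edgeDeriv (N.bdDist η) j t| ≤ 1 := by
  rw [← abs_of_pos ((hη j).2 t ht), ← abs_mul]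
  rcases lt_or_gt_of_ne h with h | h
  · rw [capacity_mul_edgeDeriv_of_lt hη ht h, abs_one]
  · rw [capacity_mul_edgeDeriv_of_gt hη ht h, abs_neg, abs_one]

/-! ### Local extrema on the network -/

/-- This restricts local extrema on the network to local extrema along each edge. -/
theorem tendsto_param {j : J} {t : ℝ} (ht : t ∈ Icc 0 (N.len j)) :
    Tendsto (N.param j) (𝓝[Icc 0 (N.len j)] t) (𝓝[N.carrier] (N.param j t)) :=
  tendsto_nhdsWithin_of_tendsto_nhds_of_eventually_within _
    ((N.param_contDiffOn j).continuousOn t ht)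
    (eventually_mem_nhdsWithin.mono fun _ hs =>
      Or.inr (mem_iUnion.2 ⟨j, mem_image_of_mem _ hs⟩))

theorem isLocalMaxOn_proj {w : EuclideanSpace ℝ (Fin n) → ℝ} {j : J} {t : ℝ}
    (ht : t ∈ Icc 0 (N.len j)) (h : IsLocalMaxOn w N.carrier (N.param j t)) :
    IsLocalMaxOn (N.proj w j) (Icc 0 (N.len j)) t :=
  (tendsto_param ht).eventually h

theorem isLocalMinOn_proj {w : EuclideanSpace ℝ (Fin n) → ℝ} {j : J} {t : ℝ}
    (ht : t ∈ Icc 0 (N.len j)) (h : IsLocalMinOn w N.carrier (N.param j t)) :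
    IsLocalMinOn (N.proj w j) (Icc 0 (N.len j)) t :=
  (tendsto_param ht).eventually h

/-- An edge which leaves a vertex uphill rules out a local maximum. -/
theorem incPlus_eq_empty_of_isLocalMaxOn [Fintype J] (hη : N.IsCapacity η) {i : I}
    (h : IsLocalMaxOn (N.bdDist η) N.carrier (N.vertex i)) : N.incPlus (N.bdDist η) i = ∅ := by
  rw [Finset.eq_empty_iff_forall_notMem]
  intro k hk
  obtain ⟨hik, hne⟩ := (mem_incPlus_iff hη).1 hk
  have ht := paramInv_mem hik
  rw [← param_paramInv hik] at h
  have h1 := isLocalMaxOn_proj ht h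
  set t := N.paramInv k (N.vertex i)
  have hp := top_mem hη k
  have gm := arcLength_mono hη k
  rcases lt_or_gt_of_ne hne with hlt | hgt
  · have hsub : Ioo t (top hη k) ⊆ Icc 0 (N.len k) :=
      fun s hs => ⟨ht.1.trans hs.1.le, hs.2.le.trans hp.2⟩
    -- Points between the vertex and the top accumulate at the vertex and have larger `d`.
    have : (𝓝[Ioo t (top hη k)] t).NeBot := left_nhdsWithin_Ioo_neBot hlt
    obtain ⟨s, hs, hs'⟩ := ((h1.filter_mono (nhdsWithin_mono t hsub)).and eventually_mem_nhdsWithin).exists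
    have hs2 := gm ht (hsub hs') hs'.1
    rw [proj_bdDist_of_le hη (hsub hs') hs'.2.le, proj_bdDist_of_le hη ht hlt.le] at hs
    linarith
  · have hsub : Ioo (top hη k) t ⊆ Icc 0 (N.len k) :=
      fun s hs => ⟨hp.1.trans hs.1.le, hs.2.le.trans ht.2⟩
    have : (𝓝[Ioo (top hη k) t] t).NeBot := right_nhdsWithin_Ioo_neBot hgt
    obtain ⟨s, hs, hs'⟩ := ((h1.filter_mono (nhdsWithin_mono t hsub)).and eventually_mem_nhdsWithin).exists
    have hs2 := gm (hsub hs') ht hs'.2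
    rw [proj_bdDist_of_ge hη (hsub hs') hs'.1.le, proj_bdDist_of_ge hη ht hgt.le] at hs
    linarith

/-! ### The eikonal equation -/

theorem nonneg_of_isLocalMinOn_left {L m : ℝ} (hL : 0 < L) {g : ℝ → ℝ}
    (h : IsLocalMinOn g (Icc 0 L) 0) (hg : HasDerivWithinAt g m (Icc 0 L) 0) : 0 ≤ m := by
  have h1 := h.hasFDerivWithinAt_nonneg hg.hasFDerivWithinAt
    (sub_mem_posTangentConeAt_of_segment_subset (y := L) (by rw [segment_eq_Icc hL.le]))
  simp only [ContinuousLinearMap.toSpanSingleton_apply, smul_eq_mul, sub_zero] at h1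
  exact (mul_nonneg_iff_of_pos_left hL).1 h1

theorem nonpos_of_isLocalMinOn_right {L m : ℝ} (hL : 0 < L) {g : ℝ → ℝ}
    (h : IsLocalMinOn g (Icc 0 L) L) (hg : HasDerivWithinAt g m (Icc 0 L) L) : m ≤ 0 := by
  have h1 := h.hasFDerivWithinAt_nonneg hg.hasFDerivWithinAt
    (sub_mem_posTangentConeAt_of_segment_subset (y := 0) (by
      rw [segment_symm, segment_eq_Icc hL.le]))
  simp only [ContinuousLinearMap.toSpanSingleton_apply, smul_eq_mul, zero_sub, neg_mul] at h1
  by_contra! hm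
  linarith [mul_pos hL hm]

/-- A test function which touches the distance at a point of differentiability of an edge has the
same slope there. -/
theorem abs_deriv_eq_of_isLocalExtr (hη : N.IsCapacity η) {φ : EuclideanSpace ℝ (Fin n) → ℝ}
    (hφ : N.IsC1 φ) {j : J} {t : ℝ} (ht : t ∈ Ioo 0 (N.len j)) (htp : t ≠ top hη j)
    (h : IsLocalExtr (fun s => N.proj (N.bdDist η) j s - N.proj φ j s) t) :
    |deriv (N.proj φ j) t| = 1 / η j t := by
  have ht' := Ioo_subset_Icc_self ht
  have hd : DifferentiableAt ℝ (N.proj φ j) t :=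
    ((hφ j).contDiffAt (Icc_mem_nhds ht.1 ht.2)).differentiableAt (by simp)
  have hpos := inv_capacity_pos hη ht'
  rcases lt_or_gt_of_ne htp with hlt | hgt
  · have h1 := h.hasDerivAt_eq_zero
      ((hasDerivAt_of_mem_Ioo ht (hasDerivWithinAt_bdDist_of_lt hη ht' hlt)).sub hd.hasDerivAt)
    rw [← sub_eq_zero.1 h1, abs_of_pos hpos]
  · have h1 := h.hasDerivAt_eq_zero
      ((hasDerivAt_of_mem_Ioo ht (hasDerivWithinAt_bdDist_of_gt hη ht' hgt)).sub hd.hasDerivAt)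
    rw [← sub_eq_zero.1 h1, abs_neg, abs_of_pos hpos]

/-- At the downhill end of an edge a test function which touches the distance from below is at least
as steep as the distance. -/
theorem exists_steep_of_isLocalMinOn (hη : N.IsCapacity η) {φ : EuclideanSpace ℝ (Fin n) → ℝ}
    (hφ : N.IsC1 φ) {i : I} {j : J} (hij : N.Incident i j)
    (hj : N.paramInv j (N.vertex i) = top hη j)
    (h : IsLocalMinOn (fun x => N.bdDist η x - φ x) N.carrier (N.vertex i)) :
    ∃ p, N.HasOrientedDeriv φ i j p ∧ 0 ≤ |p| - 1 / η j (N.paramInv j (N.vertex i)) := by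
  have hd : ∀ t ∈ Icc 0 (N.len j), DifferentiableWithinAt ℝ (N.proj φ j) (Icc 0 (N.len j)) t :=
    (hφ j).differentiableOn (by simp)
  rcases incident_iff.1 hij with rfl | rfl
  · rw [paramInv_src] at hj ⊢
    rw [← param_src] at h
    have h1 := nonneg_of_isLocalMinOn_left (N.len_pos j) (isLocalMinOn_proj (N.zero_mem j) h)
      ((hasDerivWithinAt_bdDist_zero hη hj.symm).sub (hd 0 (N.zero_mem j)).hasDerivWithinAt)
    refine ⟨_, Or.inl ⟨(param_src j).symm, (hd 0 (N.zero_mem j)).hasDerivWithinAt⟩, ?_⟩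
    linarith [neg_le_abs (derivWithin (N.proj φ j) (Icc 0 (N.len j)) 0)]
  · rw [paramInv_tgt] at hj ⊢
    rw [← param_tgt] at h
    have h1 := nonpos_of_isLocalMinOn_right (N.len_pos j) (isLocalMinOn_proj (N.len_mem j) h)
      ((hasDerivWithinAt_bdDist_len hη hj.symm).sub (hd _ (N.len_mem j)).hasDerivWithinAt)
    refine ⟨-derivWithin (N.proj φ j) (Icc 0 (N.len j)) (N.len j),
      Or.inr ⟨(param_tgt j).symm, by
        rw [neg_neg]; exact (hd _ (N.len_mem j)).hasDerivWithinAt⟩, ?_⟩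
    rw [abs_neg]
    linarith [le_abs_self (derivWithin (N.proj φ j) (Icc 0 (N.len j)) (N.len j))]

/-! ### The sandpile system -/

variable [Fintype J] {C : I → Finset J → J → ℝ}

/-- Nonemptiness of this set is what makes the distribution coefficients at the vertex available,
with sum one. -/
theorem exists_mem_incMinus (hη : N.IsCapacity η) (j₀ : J) {i : I} (hi : i ∉ N.boundary) :
    ∃ j, j ∈ N.incMinus (N.bdDist η) i := by
  obtain ⟨k, hk⟩ := exists_incident N j₀ i
  obtain ⟨j, h1, h2⟩ := exists_incident_top hη hk hi
  exact ⟨j, (mem_incMinus_iff hη).2 ⟨h1, h2⟩⟩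

open Classical in
/-- The mass leaving a vertex along an edge, counted negative if it comes in. -/
noncomputable def netOutflow (N : Network n I J) (η : J → ℝ → ℝ) (v : J → ℝ → ℝ) (i : I)
    (j : J) : ℝ :=
  (if j ∈ N.incMinus (N.bdDist η) i then v j (N.paramInv j (N.vertex i)) else 0) -
    if j ∈ N.incPlus (N.bdDist η) i then v j (N.paramInv j (N.vertex i)) else 0

/-- Mass moves against the gradient of `d`. If the edge falls away from its right end then `η d' =
1` there and the mass leaves that vertex; otherwise `η d' = -1` and the mass arrives. -/
theorem flux_len_eq (hη : N.IsCapacity η) (v : J → ℝ → ℝ) (j : J) :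
    N.flux η v j (N.len j) = N.netOutflow η v (N.tgt j) j := by
  have hi : N.Incident (N.tgt j) j := incident_tgt j
  rw [netOutflow]
  simp only [mem_incMinus_iff hη, mem_incPlus_iff hη, paramInv_tgt, hi, true_and]
  by_cases h : N.len j = top hη j
  · simp [h.symm, flux_len hη v h.symm]
  · simp [h, flux_of_gt hη v (N.len_mem j) (lt_of_le_of_ne (top_mem hη j).2 (Ne.symm h))]

theorem neg_flux_zero_eq (hη : N.IsCapacity η) (v : J → ℝ → ℝ) (j : J) :
    -N.flux η v j 0 = N.netOutflow η v (N.src j) j := by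
  have hi : N.Incident (N.src j) j := incident_src j
  rw [netOutflow]
  simp only [mem_incMinus_iff hη, mem_incPlus_iff hη, paramInv_src, hi, true_and]
  by_cases h : 0 = top hη j
  · simp [h.symm, flux_zero hη v h.symm]
  · simp [h, flux_of_lt hη v (N.zero_mem j) (lt_of_le_of_ne (top_mem hη j).1 h)]

variable [Fintype I] {v : J → ℝ → ℝ}

/-- An interior top belongs to one edge only and `v` vanishes there, so the eikonal equation is
never tested at a kink. -/
theorem Represents.ne_top_of_mem_nonzeroSet (hη : N.IsCapacity η)
    (hv : N.Represents η f C v) {j : J} {t : ℝ} (ht : t ∈ Ioo 0 (N.len j))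
    (h : N.param j t ∈ N.nonzeroSet v) : t ≠ top hη j := by
  rintro rfl
  obtain ⟨-, k, s, hs, hks, hne⟩ := h
  obtain ⟨rfl, rfl⟩ := eq_of_param_eq ht hs hks.symm
  exact hne (hv.top_eq_zero hη ht)

theorem Represents.isViscSolOn (hη : N.IsCapacity η) (hv : N.Represents η f C v) (j₀ : J) :
    N.IsViscSolOn η (N.bdDist η) (N.nonzeroSet v) := by
  refine ⟨isCont_bdDist hη, fun j t ht hA φ hφ h => ?_, fun j t ht hA φ hφ h => ?_,
    fun i hi _ φ hφ h => ?_⟩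
  · have h1 := (isLocalMaxOn_proj (Ioo_subset_Icc_self ht) h).isLocalMax
      (Icc_mem_nhds ht.1 ht.2)
    rw [abs_deriv_eq_of_isLocalExtr hη hφ ht (hv.ne_top_of_mem_nonzeroSet hη ht hA)
      (Or.inr h1), sub_self]
  · have h1 := (isLocalMinOn_proj (Ioo_subset_Icc_self ht) h).isLocalMin
      (Icc_mem_nhds ht.1 ht.2)
    rw [abs_deriv_eq_of_isLocalExtr hη hφ ht (hv.ne_top_of_mem_nonzeroSet hη ht hA)
      (Or.inl h1), sub_self]
  · obtain ⟨j, hj⟩ := exists_mem_incMinus hη j₀ hi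
    obtain ⟨h1, h2⟩ := (mem_incMinus_iff hη).1 hj
    exact ⟨j, h1, exists_steep_of_isLocalMinOn hη hφ h1 h2 h⟩

/-- The masses at a transition vertex balance. -/
theorem Represents.kirchhoff (hη : N.IsCapacity η) (hC : N.IsDistribution C)
    (hv : N.Represents η f C v) (j₀ : J) {i : I} (hi : i ∉ N.boundary) :
    ∑ j ∈ N.incMinus (N.bdDist η) i, v j (N.paramInv j (N.vertex i)) =
      ∑ j ∈ N.incPlus (N.bdDist η) i, v j (N.paramInv j (N.vertex i)) := by
  rw [Finset.sum_congr rfl fun j hj => hv.eq_of_mem_incMinus hη hj, ← Finset.sum_mul,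
    (hC i hi _ (exists_mem_incMinus hη j₀ hi)
      fun k hk => ((mem_incMinus_iff hη).1 hk).1).2, one_mul, inflow]

/-- Only the two ends of the edge contribute. This rewrites the end point terms of an integration by
parts as a sum over vertices. -/
theorem sum_netOutflow_mul (hη : N.IsCapacity η) (v : J → ℝ → ℝ) (a : I → ℝ) (j : J) :
    ∑ i, N.netOutflow η v i j * a i =
      N.flux η v j (N.len j) * a (N.tgt j) - N.flux η v j 0 * a (N.src j) := by
  classical
  rw [← Finset.sum_subset (Finset.subset_univ {N.src j, N.tgt j}),
    Finset.sum_pair (src_ne_tgt j), ← flux_len_eq hη, ← neg_flux_zero_eq hη]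
  · ring
  · intro i _ hi
    have h : ¬ N.Incident i j := by
      rw [incident_iff]
      simpa using hi
    simp [netOutflow, mem_incMinus_iff hη, mem_incPlus_iff hη, h]

/-- Integration by parts on each edge uses that the flux is a primitive of `-f`. After exchanging
the sums over edges and vertices, the end point terms vanish at transition vertices by the mass
balance and at boundary vertices because `ψ = 0`. -/
theorem Represents.weak_conservation (hη : N.IsCapacity η) (hf : N.IsSource f)
    (hC : N.IsDistribution C) (hv : N.Represents η f C v) (j₀ : J)
    {ψ : EuclideanSpace ℝ (Fin n) → ℝ} {Dψ : J → ℝ → ℝ} (hψ : N.IsCont ψ)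
    (hψ' : ∀ j, IsW1InftyWith (N.len j) (N.proj ψ j) (Dψ j))
    (h0 : ∀ i ∈ N.boundary, ψ (N.vertex i) = 0) :
    ∑ j, ∫ t in 0..N.len j, v j t * η j t * N.edgeDeriv (N.bdDist η) j t * Dψ j t =
      ∑ j, ∫ t in 0..N.len j, f j t * N.proj ψ j t := by
  have key : ∀ j, ∫ t in 0..N.len j, v j t * η j t * N.edgeDeriv (N.bdDist η) j t * Dψ j t =
      (∑ i, N.netOutflow η v i j * ψ (N.vertex i)) +
        ∫ t in 0..N.len j, f j t * N.proj ψ j t := by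
    intro j
    have h1 := integral_mul_of_primitive (N.len_pos j).le
      (intervalIntegrable_of_memLp_edgeMeasure (hf.1 j).neg (N.zero_mem j) (N.len_mem j))
      (intervalIntegrable_of_memLp_edgeMeasure (hψ' j).2.1 (N.zero_mem j) (N.len_mem j))
      (fun t ht => hv.flux_eq_primitive hη hf ht)
      (eq_primitive_of_isW1InftyWith (N.len_pos j) (hψ j) (hψ' j))
    simp only [Pi.neg_apply, neg_mul, intervalIntegral.integral_neg, sub_neg_eq_add] at h1
    rw [sum_netOutflow_mul hη, ← param_src, ← param_tgt]
    exact h1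
  rw [Finset.sum_congr rfl fun j _ => key j, Finset.sum_add_distrib, Finset.sum_comm,
    Finset.sum_eq_zero, zero_add]
  intro i _
  rw [← Finset.sum_mul]
  by_cases hi : i ∈ N.boundary
  · rw [h0 i hi, mul_zero]
  · simp only [netOutflow, Finset.sum_sub_distrib, Finset.sum_ite_mem, Finset.univ_inter]
    rw [hv.kirchhoff hη hC j₀ hi, sub_self, zero_mul]

theorem Represents.transmission (hη : N.IsCapacity η) (hv : N.Represents η f C v) :
    N.Transmission C (N.bdDist η) v := fun _ _ =>
  ⟨fun _ hij h => absurd (slopeDefined_bdDist hη hij) h,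
    fun _ hj => hv.eq_of_mem_incMinus hη hj⟩

theorem Represents.isSandpileSolution (hη : N.IsCapacity η) (hf : N.IsSource f)
    (hC : N.IsDistribution C) (hv : N.Represents η f C v)
    (hv0 : ∀ j, ∀ t ∈ Icc 0 (N.len j), 0 ≤ v j t) :
    N.IsSandpileSolution η f C (N.bdDist η) v := by
  -- A nonzero source guarantees that the network has an edge.
  obtain ⟨j₀, -⟩ := hf.2.2
  refine ⟨hv.continuousOn hη hf, hv0, isCont_bdDist hη, fun x _ => bdDist_nonneg x,
    ⟨_, isW1InftyWith_proj_bdDist hη, fun j => ?_, fun ψ Dψ h1 h2 h3 =>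
      hv.weak_conservation hη hf hC j₀ h1 h2 h3⟩, hv.isViscSolOn hη j₀, fun i hi => ?_,
    hv.transmission hη⟩
  · refine (ae_restrict_iff' measurableSet_Ioo).2 ?_
    filter_upwards [Measure.ae_ne volume (top hη j)] with r hr hr'
    exact capacity_mul_abs_edgeDeriv_le hη (Ioo_subset_Icc_self hr') hr
  · obtain ⟨k, hk⟩ := exists_incident N j₀ i
    exact bdDist_boundary hk hi

/-- At a vertex where `d` has a local maximum no edge rises, so the inflow is an empty sum and every
incident edge receives a share of zero. -/
theorem Represents.eq_zero_of_mem_singSet (hη : N.IsCapacity η) (hv : N.Represents η f C v)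
    {j : J} {t : ℝ} (ht : t ∈ Icc 0 (N.len j)) (h : N.param j t ∈ N.singSet (N.bdDist η)) :
    v j t = 0 := by
  rcases h with h | ⟨i, hi, hmax⟩
  · obtain ⟨k, s, hs, hst⟩ := mem_iUnion.1 h
    obtain ⟨h1, h2⟩ := (mem_singEdge_iff hη).1 hs
    obtain ⟨rfl, rfl⟩ := eq_of_param_eq h1 ht hst
    rw [h2] at h1 ⊢
    exact hv.top_eq_zero hη h1
  · have he := incPlus_eq_empty_of_isLocalMaxOn hη hmax
    have hij : N.Incident i j := ⟨t, ht, hi⟩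
    have hj : j ∈ N.incMinus (N.bdDist η) i := by
      by_contra h'
      have h2 : j ∈ N.incPlus (N.bdDist η) i :=
        (mem_incPlus_iff hη).2 ⟨hij, fun h3 => h' ((mem_incMinus_iff hη).2 ⟨hij, h3⟩)⟩
      simp [he] at h2
    have h1 := hv.eq_of_mem_incMinus hη hj
    rwa [← hi, paramInv_param ht, inflow, he, Finset.sum_empty, mul_zero] at h1

end Network

/-! ### The theorem -/

theorem mainTheorem1 {n : ℕ} {I J : Type*} [Fintype I] [Fintype J] (N : Network n I J)
    (η : J → ℝ → ℝ) (hη : N.IsCapacity η) (f : J → ℝ → ℝ) (hf : N.IsSource f)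
    (C : I → Finset J → J → ℝ) (hC : N.IsDistribution C) :
    -- the projection sets are singletons and the minima defining `τ_j` are attained
    (∀ j, (∃ p, N.projSet (N.bdDist η) j = {p}) ∧
      ∀ t ∈ Icc 0 (N.len j), IsLeast (N.hitTimes η j t) (N.tau η j t)) ∧
    -- the representation formula determines `v^f`
    ∃ v : J → ℝ → ℝ, N.Represents η f C v ∧
      (∀ w : J → ℝ → ℝ, N.Represents η f C w → ∀ j, EqOn (w j) (v j) (Icc 0 (N.len j))) ∧
      -- `(d, v^f)` is a solution
      N.IsSandpileSolution η f C (N.bdDist η) v ∧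
      -- `v^f` vanishes on `S(d)`
      (∀ j, ∀ t ∈ Icc 0 (N.len j), N.param j t ∈ N.singSet (N.bdDist η) → v j t = 0) ∧
      -- `v^f` belongs to `W^{1,∞}`
      (∀ j, ∃ v' : ℝ → ℝ, IsW1InftyWith (N.len j) (v j) v') ∧
      -- the conservation law holds pointwise on the edges away from the singular points
      (∀ j, (∀ᵐ t, t ∈ Ioo 0 (N.len j) \ N.singEdge (N.bdDist η) j →
          HasDerivAt (N.flux η v j) (-f j t) t) ∧
        ∀ t ∈ Ioo 0 (N.len j) \ N.singEdge (N.bdDist η) j, ContinuousAt (f j) t →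
          HasDerivAt (N.flux η v j) (-f j t) t) := by
  obtain ⟨v, hv, huniq, hv0⟩ := Network.exists_represents (N := N) hη hf hC
  refine ⟨fun j => ⟨⟨_, Network.projSet_eq hη j⟩, fun t ht => ?_⟩, v, hv, huniq,
    hv.isSandpileSolution hη hf hC hv0, fun j t ht h => hv.eq_zero_of_mem_singSet hη ht h,
    fun j => ⟨_, hv.isW1InftyWith hη hf j⟩, fun j => ⟨?_, fun t ht h =>
      hv.hasDerivAt_flux_of_continuousAt hη hf ht.1 h⟩⟩
  · rw [Network.tau_eq hη ht]
    exact Network.isLeast_hitTimes hη ht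
  · filter_upwards [hv.ae_hasDerivAt_flux hη hf j] with t ht ht'
    exact ht ht'.1
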